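/- All logarithms are to base $2$, and graphs are finite and simple. For a graph $G$, let $\mathcal{C}(G)$ denote its cycle spectrum, i.e. the set of integers $k$ such that $G$ contains a cycle of length $k$. There is an absolute constant $c > 0$ such that every $n$-vertex Hamiltonian graph $G$ (a graph having a cycle through all of its vertices) with minimum degree $\delta(G) \ge 3$ satisfies $$|\mathcal{C}(G)| \;\ge\; c\cdot\frac{n}{2^{6\sqrt{\log n\,\log\log n}}}.$$ Consequently, such a graph has cycles of at least $n^{1-o(1)}$ different lengths: there is a function $\varepsilon:\mathbb{N}\to\mathbb{R}$ with $\varepsilon(n)\to 0$ as $n\to\infty$ such that every $n$-vertex Hamiltonian graph $G$ with $\delta(G)\ge 3$ satisfies $|\mathcal{C}(G)|\ge n^{1-\varepsilon(n)}$. -/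

import Mathlib

/-- The cycle spectrum of a graph: the set of lengths (numbers of edges) of its cycles. -/
def SimpleGraph.cycleSpectrum {V : Type*} (G : SimpleGraph V) : Set ℕ :=
  {k | ∃ (v : V) (p : G.Walk v v), p.IsCycle ∧ p.length = k}

/-- The cycle spectrum of a finite graph is finite, so its `Set.ncard` is its true size. -/
theorem SimpleGraph.cycleSpectrum_finite {V : Type*} [Fintype V] (G : SimpleGraph V) :
    G.cycleSpectrum.Finite := by
  refine (Set.finite_Iic (Fintype.card V)).subset ?_
  rintro k ⟨v, p, hp, rfl⟩
  have h := hp.support_nodup.length_le_card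
  simpa [SimpleGraph.Walk.length_support] using h

universe u

/-! Number the vertices along the Hamiltonian cycle. Every vertex has a third neighbour, so in one
of the two directions a positive proportion of vertices `a` send a chord forward to `a + x a`. Once
the closing edge is removed, it suffices to find many lengths of paths from the first vertex to the
last. Pigeonholing chords by dyadic length and by position cuts the spine into consecutive segments
in each of which all chosen chords pass over a common point. Lengths in different segments can be
combined freely, and by Cauchy–Davenport the numbers of lengths, each minus one, add up
(`exists_lengths_append`).

In one segment, an odd chain of pairwise crossing chords gives a zigzag path whose length is a
constant plus a sum of terms `x p' - x p + 2` minus `x e` for the last chord `e`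
(`exists_hasPath_of_evenVal`). So the problem is to count values of chains (`exists_oddVal`). Chord
lengths are viewed at the scales `r ^ h`. If few chords share a length up to scale `0`, single
chords give enough values. Otherwise there is a scale at which cells of lengths are heavy while the
next larger cells are not; then there are many heavy cells, and it remains to show that each yields
a positive fraction (up to `4 ^ h`) of an interval of values.

That is `fills_of_isFamily`, by induction on the scale: groups of chords either contain a pair of
large value `d`, and many such pairs form a progression of step about `d` whose gaps are filled by
smaller scales, or they split into many groups at the next smaller scale.

The total loss is `2 ^ O(k)` times a polynomial in `r` and `log n`, where `r ^ k` is about `n`.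
Taking `r = 2 ^ m` and `k = m` with `m` about `√(log n)` gives a loss `2 ^ O(√(log n))`, smaller
than required. -/

section CycleLengths

open Finset

/-! ### Chains of crossing chords and their values. -/

/-- The chord from `a` to `a + x a` crosses the chord from `b` to `b + x b`, with `a` first. -/
def Prec (x : ℕ → ℕ) (a b : ℕ) : Prop := a < b ∧ a + x a < b + x b

/-- The values of chains of even length for `Prec` in `S`: a consecutive pair `p, p'` contributes
`x p' - x p + 2`. -/
inductive EvenVal (x : ℕ → ℕ) : Set ℕ → ℤ → Prop
  | nil (S : Set ℕ) : EvenVal x S 0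
  | cons (S S' : Set ℕ) (p p' : ℕ) (z : ℤ) (hp : p ∈ S) (hp' : p' ∈ S) (hpp : Prec x p p')
      (hS : S' ⊆ S) (h : EvenVal x S' z) (hlt : ∀ y ∈ S', Prec x p' y) :
      EvenVal x S (z + ((x p' : ℤ) - x p + 2))

theorem EvenVal.mono {x : ℕ → ℕ} {S T : Set ℕ} {z : ℤ} (h : EvenVal x S z) (hST : S ⊆ T) :
    EvenVal x T z := by
  cases h with
  | nil => exact .nil T
  | cons _ S' p p' z hp hp' hpp hS h hlt =>
    exact .cons T S' p p' z (hST hp) (hST hp') hpp (hS.trans hST) h hlt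

theorem EvenVal.pair {x : ℕ → ℕ} {S : Set ℕ} {p p' : ℕ} (hp : p ∈ S) (hp' : p' ∈ S)
    (h : Prec x p p') : EvenVal x S ((x p' : ℤ) - x p + 2) := by
  simpa using EvenVal.cons S ∅ p p' 0 hp hp' h (Set.empty_subset _) (.nil _) (by simp)

theorem EvenVal.add {x : ℕ → ℕ} {S T : Set ℕ} {z z' : ℤ} (h : EvenVal x S z)
    (h' : EvenVal x T z') (hST : ∀ a ∈ S, ∀ b ∈ T, Prec x a b) : EvenVal x (S ∪ T) (z + z') := by
  induction h with
  | nil S => simpa using h'.mono Set.subset_union_right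
  | cons S S' p p' z hp hp' hpp hS h hlt ih =>
    have := EvenVal.cons (S ∪ T) (S' ∪ T) p p' _ (Or.inl hp) (Or.inl hp') hpp
      (Set.union_subset_union_left _ hS) (ih fun a ha b hb => hST a (hS ha) b hb)
      (by
        rintro y (hy | hy)
        · exact hlt y hy
        · exact hST p' hp' y hy)
    convert this using 1
    ring

/-- All elements of `G` precede all elements of `G'`. -/
def AllPrec (x : ℕ → ℕ) (G G' : Finset ℕ) : Prop := ∀ a ∈ G, ∀ b ∈ G', Prec x a b

theorem AllPrec.mono {x : ℕ → ℕ} {G G' H H' : Finset ℕ} (h : AllPrec x G G') (hG : H ⊆ G)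
    (hG' : H' ⊆ G') : AllPrec x H H' := fun a ha b hb => h a (hG ha) b (hG' hb)

/-- Any two members of the family are comparable. -/
def Comparable (x : ℕ → ℕ) (F : Finset (Finset ℕ)) : Prop :=
  ∀ G ∈ F, ∀ G' ∈ F, G ≠ G' → AllPrec x G G' ∨ AllPrec x G' G

theorem Comparable.mono {x : ℕ → ℕ} {F F' : Finset (Finset ℕ)} (h : Comparable x F)
    (hF : F' ⊆ F) : Comparable x F' := fun G hG G' hG' => h G (hF hG) G' (hF hG')

/-- Among comparable sets, the one with the largest maximum comes after all the others, so its chain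
can be appended last. -/
theorem evenVal_sum {x : ℕ → ℕ} (F : Finset (Finset ℕ)) (v : Finset ℕ → ℤ) :
    Comparable x F → (∀ G ∈ F, EvenVal x G (v G)) →
      EvenVal x {a | ∃ G ∈ F, a ∈ G} (∑ G ∈ F, v G) := by
  induction F using Finset.induction_on_max_value (fun G : Finset ℕ => G.sup id) with
  | empty => intro _ _; simpa using EvenVal.nil _
  | insert G F hG hmax ih =>
    intro hc hv
    rw [Finset.sum_insert hG, add_comm]
    have h1 := ih (hc.mono (Finset.subset_insert _ _))
      (fun G' hG' => hv G' (Finset.mem_insert_of_mem hG'))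
    refine (h1.add (hv G (Finset.mem_insert_self _ _)) ?_).mono ?_
    · rintro a ⟨G', hG', ha⟩ b hb
      have hne : G' ≠ G := fun h => hG (h ▸ hG')
      rcases hc G' (Finset.mem_insert_of_mem hG') G (Finset.mem_insert_self _ _) hne with h | h
      · exact h a ha b hb
      · exfalso
        have h2 := hmax G' hG'
        obtain ⟨c, hc, hcm⟩ := Finset.exists_mem_eq_sup G ⟨b, hb⟩ id
        have h3 : a ≤ G'.sup id := Finset.le_sup (f := id) ha
        have h4 := (h c hc a ha).1
        simp only [id] at hcm h2 h3
        omega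
    · rintro a (⟨G', hG', ha⟩ | ha)
      · exact ⟨G', Finset.mem_insert_of_mem hG', ha⟩
      · exact ⟨G, Finset.mem_insert_self _ _, ha⟩

/-- `z` is a sum of values of even chains, one in each member of the family. -/
def FamVal (x : ℕ → ℕ) (F : Finset (Finset ℕ)) (z : ℤ) : Prop :=
  ∃ v : Finset ℕ → ℤ, (∀ G ∈ F, EvenVal x G (v G)) ∧ z = ∑ G ∈ F, v G

theorem FamVal.evenVal {x : ℕ → ℕ} {F : Finset (Finset ℕ)} {z : ℤ} (h : FamVal x F z)
    (hc : Comparable x F) : EvenVal x {a | ∃ G ∈ F, a ∈ G} z := by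
  obtain ⟨v, hv, rfl⟩ := h
  exact evenVal_sum F v hc hv

theorem famVal_zero (x : ℕ → ℕ) (F : Finset (Finset ℕ)) : FamVal x F 0 :=
  ⟨fun _ => 0, fun G _ => .nil _, by simp⟩

theorem FamVal.add {x : ℕ → ℕ} {F F' : Finset (Finset ℕ)} {z z' : ℤ} (h : FamVal x F z)
    (h' : FamVal x F' z') (hd : Disjoint F F') : FamVal x (F ∪ F') (z + z') := by
  obtain ⟨v, hv, rfl⟩ := h
  obtain ⟨v', hv', rfl⟩ := h'
  refine ⟨fun G => if G ∈ F then v G else v' G, ?_, ?_⟩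
  · intro G hG
    by_cases hGF : G ∈ F
    · simpa [hGF] using hv G hGF
    · simpa [hGF] using hv' G ((Finset.mem_union.1 hG).resolve_left hGF)
  · rw [Finset.sum_union hd]
    congr 1
    · exact Finset.sum_congr rfl fun G hG => by simp [hG]
    · exact Finset.sum_congr rfl fun G hG => by
        simp [Finset.disjoint_right.1 hd hG]

/-- The additional members contribute the empty chain, of value `0`. -/
theorem FamVal.mono {x : ℕ → ℕ} {F F' : Finset (Finset ℕ)} {z : ℤ} (h : FamVal x F z)
    (hF : F ⊆ F') : FamVal x F' z := by
  have := h.add (famVal_zero x (F' \ F)) Finset.disjoint_sdiff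
  rwa [Finset.union_sdiff_of_subset hF, add_zero] at this

theorem famVal_sum {x : ℕ → ℕ} {F : Finset (Finset ℕ)} (v : Finset ℕ → ℤ)
    (h : ∀ G ∈ F, EvenVal x G (v G)) : FamVal x F (∑ G ∈ F, v G) := ⟨v, h, rfl⟩

/-! ### Families of groups of chords, and how to cut them. -/

/-- A family of pairwise comparable sets of at least `g` chords, the lengths of the chords in one
set lying in an interval of length `q`. -/
structure IsFamily (x : ℕ → ℕ) (q g : ℕ) (F : Finset (Finset ℕ)) : Prop where
  card : ∀ G ∈ F, g ≤ #G
  window : ∀ G ∈ F, ∃ c : ℤ, ∀ a ∈ G, c ≤ x a ∧ (x a : ℤ) < c + q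
  comp : Comparable x F

theorem IsFamily.mono {x : ℕ → ℕ} {q g : ℕ} {F F' : Finset (Finset ℕ)} (h : IsFamily x q g F)
    (hF : F' ⊆ F) : IsFamily x q g F' :=
  ⟨fun G hG => h.card G (hF hG), fun G hG => h.window G (hF hG), h.comp.mono hF⟩

/-- Refining every member of a family. -/
theorem IsFamily.refine {x : ℕ → ℕ} {q g N : ℕ} {F : Finset (Finset ℕ)} (hg : 0 < g)
    (hc : Comparable x F) (ch : Finset ℕ → Finset (Finset ℕ))
    (hch : ∀ G ∈ F, IsFamily x q g (ch G) ∧ #(ch G) = N ∧ ∀ H ∈ ch G, H ⊆ G) :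
    IsFamily x q g (F.biUnion ch) ∧ #(F.biUnion ch) = #F * N ∧
      ∀ z, FamVal x (F.biUnion ch) z → FamVal x F z := by
  have hdisj : (F : Set (Finset ℕ)).PairwiseDisjoint ch := by
    intro G hG G' hG' hne
    rw [Function.onFun, Finset.disjoint_left]
    intro H hH hH'
    have h1 := (hch G hG).2.2 H hH
    have h2 := (hch G' hG').2.2 H hH'
    -- A nonempty set cannot lie in two comparable members, so refinements of different members
    -- never coincide and the count is exact.
    obtain ⟨a, ha⟩ : H.Nonempty := Finset.card_pos.1 (hg.trans_le ((hch G hG).1.card H hH))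
    rcases hc G hG G' hG' hne with h | h
    · exact absurd (h a (h1 ha) a (h2 ha)).1 (lt_irrefl _)
    · exact absurd (h a (h2 ha) a (h1 ha)).1 (lt_irrefl _)
  refine ⟨⟨?_, ?_, ?_⟩, ?_, ?_⟩
  · intro H hH
    obtain ⟨G, hG, hH⟩ := Finset.mem_biUnion.1 hH
    exact (hch G hG).1.card H hH
  · intro H hH
    obtain ⟨G, hG, hH⟩ := Finset.mem_biUnion.1 hH
    exact (hch G hG).1.window H hH
  · intro H hH H' hH' hne
    obtain ⟨G, hG, hH⟩ := Finset.mem_biUnion.1 hH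
    obtain ⟨G', hG', hH'⟩ := Finset.mem_biUnion.1 hH'
    by_cases h : G = G'
    · subst h
      exact (hch G hG).1.comp H hH H' hH' hne
    · have h1 := (hch G hG).2.2 H hH
      have h2 := (hch G' hG').2.2 H' hH'
      exact (hc G hG G' hG' h).imp (fun h => h.mono h1 h2) (fun h => h.mono h2 h1)
  · rw [Finset.card_biUnion hdisj, Finset.sum_congr rfl fun G hG => (hch G hG).2.1]
    simp
  · rintro z ⟨v, hv, rfl⟩
    rw [Finset.sum_biUnion hdisj]
    refine famVal_sum _ fun G hG => ?_
    refine (evenVal_sum (ch G) v (hch G hG).1.comp fun H hH =>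
      hv H (Finset.mem_biUnion.2 ⟨G, hG, hH⟩)).mono ?_
    rintro a ⟨H, hH, ha⟩
    exact (hch G hG).2.2 H hH ha

theorem exists_card_filter_lt_eq (S : Finset ℕ) (m : ℕ) (h : m ≤ #S) :
    ∃ t, #{a ∈ S | a < t} = m := by
  induction m with
  | zero => exact ⟨0, by simp⟩
  | succ m ih =>
    obtain ⟨t, ht⟩ := ih (by omega)
    have hne : {a ∈ S | t ≤ a}.Nonempty := by
      rw [Finset.nonempty_iff_ne_empty]
      intro he
      have h1 := Finset.card_filter_add_card_filter_not (s := S) (fun a => a < t)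
      simp only [not_lt] at h1
      rw [he, ht] at h1
      simp at h1
      omega
    have hmem := Finset.min'_mem _ hne
    set u := Finset.min' _ hne with hu
    rw [Finset.mem_filter] at hmem
    refine ⟨u + 1, ?_⟩
    have : {a ∈ S | a < u + 1} = insert u {a ∈ S | a < t} := by
      ext a
      simp only [Finset.mem_filter, Finset.mem_insert]
      constructor
      · rintro ⟨ha, hau⟩
        by_cases hat : a < t
        · exact Or.inr ⟨ha, hat⟩
        · left
          have : u ≤ a := Finset.min'_le _ _ (Finset.mem_filter.2 ⟨ha, by omega⟩)
          omega
      · rintro (rfl | ⟨ha, hat⟩)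
        · exact ⟨hmem.1, by omega⟩
        · exact ⟨ha, by omega⟩
    rw [this, Finset.card_insert_of_notMem (by simp; omega), ht]

/-- Only `q` integers lie in `[t, t + q)`, so a gap of length `q` between starting points costs at
most `q` chords. -/
theorem exists_cut (S : Finset ℕ) (m q : ℕ) (h : m ≤ #S) :
    ∃ t, #{a ∈ S | a < t} = m ∧ #S ≤ m + q + #{a ∈ S | t + q ≤ a} := by
  obtain ⟨t, ht⟩ := exists_card_filter_lt_eq S m h
  refine ⟨t, ht, ?_⟩
  have h1 : S ⊆ {a ∈ S | a < t} ∪ (Finset.Ico t (t + q) ∪ {a ∈ S | t + q ≤ a}) := by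
    intro a ha
    simp only [Finset.mem_union, Finset.mem_filter, Finset.mem_Ico, ha, true_and]
    omega
  have h2 := Finset.card_le_card h1
  have h3 := Finset.card_union_le {a ∈ S | a < t} (Finset.Ico t (t + q) ∪ {a ∈ S | t + q ≤ a})
  have h4 := Finset.card_union_le (Finset.Ico t (t + q)) {a ∈ S | t + q ≤ a}
  simp at h4
  omega

theorem exists_chop (g q : ℕ) (hg : 0 < g) (N : ℕ) : ∀ S : Finset ℕ, N * (g + q) ≤ #S →
    ∃ F : Finset (Finset ℕ), #F = N ∧ (∀ G ∈ F, G ⊆ S ∧ #G = g) ∧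
      ∀ G ∈ F, ∀ G' ∈ F, G ≠ G' →
        (∀ a ∈ G, ∀ b ∈ G', a + q ≤ b) ∨ (∀ a ∈ G', ∀ b ∈ G, a + q ≤ b) := by
  induction N with
  | zero => intro S _; exact ⟨∅, by simp⟩
  | succ N ih =>
    intro S hS
    obtain ⟨t, ht, hS'⟩ := exists_cut S g q (by nlinarith)
    obtain ⟨F, hF, hFS, hsep⟩ := ih {a ∈ S | t + q ≤ a} (by nlinarith)
    have hnew : ∀ G ∈ F, ∀ a ∈ {a ∈ S | a < t}, ∀ b ∈ G, a + q ≤ b := by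
      intro G hG a ha b hb
      have h1 := (Finset.mem_filter.1 ((hFS G hG).1 hb)).2
      have h2 := (Finset.mem_filter.1 ha).2
      omega
    refine ⟨insert {a ∈ S | a < t} F, ?_, ?_, ?_⟩
    · rw [Finset.card_insert_of_notMem, hF]
      intro hmem
      obtain ⟨a, ha⟩ := Finset.card_pos.1 (ht ▸ hg)
      have h1 := (Finset.mem_filter.1 ((hFS _ hmem).1 ha)).2
      have h2 := (Finset.mem_filter.1 ha).2
      omega
    · intro G hG
      rcases Finset.mem_insert.1 hG with rfl | hG
      · exact ⟨Finset.filter_subset _ _, ht⟩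
      · exact ⟨(hFS G hG).1.trans (Finset.filter_subset _ _), (hFS G hG).2⟩
    · intro G hG G' hG' hne
      rcases Finset.mem_insert.1 hG with rfl | hG <;> rcases Finset.mem_insert.1 hG' with rfl | hG'
      · exact absurd rfl hne
      · exact Or.inl (hnew G' hG')
      · exact Or.inr (hnew G hG)
      · exact hsep G hG G' hG' hne

/-- The reason for leaving gaps: if lengths vary by less than `q`, a gap of `q` between starting
points keeps the end points in order too. -/
theorem prec_of_window {x : ℕ → ℕ} {q : ℕ} {c : ℤ} {a b : ℕ}
    (ha : c ≤ x a ∧ (x a : ℤ) < c + q) (hb : c ≤ x b ∧ (x b : ℤ) < c + q) (hab : a + q ≤ b) :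
    Prec x a b := ⟨by omega, by omega⟩

theorem exists_isFamily_of_window {x : ℕ → ℕ} {q g N : ℕ} {c : ℤ} (hg : 0 < g)
    {S : Finset ℕ} (hS : N * (g + q) ≤ #S) (hw : ∀ a ∈ S, c ≤ x a ∧ (x a : ℤ) < c + q) :
    ∃ F, IsFamily x q g F ∧ #F = N ∧ ∀ G ∈ F, G ⊆ S := by
  obtain ⟨F, hF, hFS, hsep⟩ := exists_chop g q hg N S hS
  refine ⟨F, ⟨fun G hG => (hFS G hG).2.ge, fun G hG => ⟨c, fun a ha => hw a ((hFS G hG).1 ha)⟩,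
    ?_⟩, hF, fun G hG => (hFS G hG).1⟩
  intro G hG G' hG' hne
  refine (hsep G hG G' hG' hne).imp ?_ ?_
  · intro h a ha b hb
    exact prec_of_window (hw a ((hFS G hG).1 ha)) (hw b ((hFS G' hG').1 hb)) (h a ha b hb)
  · intro h a ha b hb
    exact prec_of_window (hw a ((hFS G' hG').1 ha)) (hw b ((hFS G hG).1 hb)) (h a ha b hb)

theorem exists_subset_window {x : ℕ → ℕ} {r q g : ℕ} {c : ℤ} {G : Finset ℕ} (hr : 0 < r)
    (hq : 0 < q) (hG : r * g ≤ #G) (hw : ∀ a ∈ G, c ≤ x a ∧ (x a : ℤ) < c + (r * q : ℕ)) :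
    ∃ G' ⊆ G, g ≤ #G' ∧ ∃ c' : ℤ, ∀ a ∈ G', c' ≤ x a ∧ (x a : ℤ) < c' + q := by
  have hq' : (0 : ℤ) < q := by exact_mod_cast hq
  obtain ⟨y, -, hy⟩ := Finset.exists_le_card_fiber_of_mul_le_card_of_maps_to
    (s := G) (t := Finset.range r) (f := fun a => (((x a : ℤ) - c) / q).toNat) (n := g)
    (by
      intro a ha
      have h := hw a ha
      have h1 : ((x a : ℤ) - c) / q < r := by
        rw [Int.ediv_lt_iff_lt_mul hq']
        push_cast at h
        linarith
      have h2 : 0 ≤ ((x a : ℤ) - c) / q := Int.ediv_nonneg (by linarith) hq'.le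
      rw [Finset.mem_range]
      omega)
    (by simpa using hr.ne') (by simpa using hG)
  refine ⟨_, Finset.filter_subset _ _, hy, c + q * y, ?_⟩
  intro a ha
  obtain ⟨ha, hay⟩ := Finset.mem_filter.1 ha
  have h := hw a ha
  have h2 : 0 ≤ ((x a : ℤ) - c) / q := Int.ediv_nonneg (by linarith) hq'.le
  have h3 : ((x a : ℤ) - c) / q = y := by omega
  have h4 := Int.mul_ediv_self_le (x := (x a : ℤ) - c) hq'.ne'
  have h5 := Int.lt_mul_ediv_self_add (x := (x a : ℤ) - c) hq'
  rw [h3] at h4 h5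
  constructor <;> linarith

/-! ### Sums of a progression and a short set. -/

/-- A chain of subsets of `E` along which the sum of `δ` moves monotonically, with steps
in `[d, 2d)`. -/
theorem exists_subset_sums {ι : Type*} [DecidableEq ι] (δ : ι → ℤ) (d σ : ℤ) (E : Finset ι) :
    (∀ i ∈ E, d ≤ σ * δ i ∧ σ * δ i < 2 * d) →
    ∃ U : ℕ → Finset ι, (∀ j, U j ⊆ E) ∧ U 0 = ∅ ∧ U #E = E ∧ ∀ j < #E,
      d ≤ σ * (∑ i ∈ U (j + 1), δ i - ∑ i ∈ U j, δ i) ∧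
        σ * (∑ i ∈ U (j + 1), δ i - ∑ i ∈ U j, δ i) < 2 * d := by
  induction E using Finset.induction_on with
  | empty => intro _; exact ⟨fun _ => ∅, by simp⟩
  | insert a s ha ih =>
    intro h
    obtain ⟨U, hU, hU0, hUs, hstep⟩ := ih fun i hi => h i (Finset.mem_insert_of_mem hi)
    refine ⟨fun j => if j ≤ #s then U j else insert a s, ?_, ?_, ?_, ?_⟩
    · intro j
      dsimp only
      split_ifs
      · exact (hU j).trans (Finset.subset_insert _ _)
      · exact subset_rfl
    · simp [hU0]
    · simp [Finset.card_insert_of_notMem ha]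
    · intro j hj
      rw [Finset.card_insert_of_notMem ha] at hj
      rcases Nat.lt_succ_iff_lt_or_eq.1 hj with hj | rfl
      · simpa [hj.le, Nat.succ_le_of_lt hj] using hstep j hj
      · simp only [add_le_iff_nonpos_right, le_refl, if_true, hUs]
        simpa [Finset.sum_insert ha] using h a (Finset.mem_insert_self _ _)

theorem mul_sub_bounds_of_steps {y : ℕ → ℤ} {d σ : ℤ} {t : ℕ}
    (h : ∀ j < t, d ≤ σ * (y (j + 1) - y j) ∧ σ * (y (j + 1) - y j) < 2 * d) (i : ℕ) :
    ∀ j, i ≤ j → j ≤ t →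
      d * (j - i) ≤ σ * (y j - y i) ∧ σ * (y j - y i) ≤ 2 * d * (j - i) := by
  intro j hij
  induction j, hij using Nat.le_induction with
  | base => intro _; simp
  | succ j hij ih =>
    intro hj
    have h1 := ih (by omega)
    have h2 := h j (by omega)
    push_cast
    constructor <;> nlinarith

/-- Adding a `d`-separated progression to a set of diameter less than `d`. -/
theorem exists_sumset_of_steps {y : ℕ → ℤ} {d σ : ℤ} {t : ℕ} (hσ : σ = 1 ∨ σ = -1) (hd : 0 < d)
    (h : ∀ j < t, d ≤ σ * (y (j + 1) - y j) ∧ σ * (y (j + 1) - y j) < 2 * d) (hy0 : y 0 = 0)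
    {W : Finset ℤ} (h0 : (0 : ℤ) ∈ W) (hW : ∀ z ∈ W, ∀ z' ∈ W, z - z' < d) :
    ∃ W' : Finset ℤ, 0 ∈ W' ∧ (∀ z ∈ W', ∃ j ≤ t, ∃ w ∈ W, z = y j + w) ∧
      (∀ z ∈ W', ∀ z' ∈ W', z - z' < 2 * d * t + d) ∧ #W' = (t + 1) * #W := by
  have hb := mul_sub_bounds_of_steps h
  have habs : ∀ i j, i ≤ j → j ≤ t →
      d * (j - i) ≤ |y j - y i| ∧ |y j - y i| ≤ 2 * d * (j - i) := by
    intro i j hij hjt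
    have h1 := hb i j hij hjt
    have h2 : |y j - y i| = σ * (y j - y i) := by
      have h3 : (0 : ℤ) ≤ σ * (y j - y i) := by
        refine le_trans (mul_nonneg hd.le ?_) h1.1
        have : (i : ℤ) ≤ j := by exact_mod_cast hij
        linarith
      rcases hσ with rfl | rfl
      · rw [abs_of_nonneg (by linarith)]; ring
      · rw [abs_of_nonpos (by linarith)]; ring
    rwa [h2]
  refine ⟨(Finset.range (t + 1) ×ˢ W).image fun p => y p.1 + p.2, ?_, ?_, ?_, ?_⟩
  · exact Finset.mem_image.2 ⟨(0, 0), by simp [h0], by simp [hy0]⟩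
  · intro z hz
    obtain ⟨⟨j, w⟩, hp, rfl⟩ := Finset.mem_image.1 hz
    simp only [Finset.mem_product, Finset.mem_range] at hp
    exact ⟨j, by omega, w, hp.2, rfl⟩
  · intro z hz z' hz'
    obtain ⟨⟨j, w⟩, hp, rfl⟩ := Finset.mem_image.1 hz
    obtain ⟨⟨i, w'⟩, hp', rfl⟩ := Finset.mem_image.1 hz'
    simp only [Finset.mem_product, Finset.mem_range] at hp hp'
    have hw := hW w hp.2 w' hp'.2
    have hle : |y j - y i| ≤ 2 * d * t := by
      rcases le_total i j with hij | hij
      · refine (habs i j hij (by omega)).2.trans (mul_le_mul_of_nonneg_left ?_ (by linarith))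
        have : (j : ℤ) ≤ t := by exact_mod_cast (by omega : j ≤ t)
        omega
      · rw [abs_sub_comm]
        refine (habs j i hij (by omega)).2.trans (mul_le_mul_of_nonneg_left ?_ (by linarith))
        have : (i : ℤ) ≤ t := by exact_mod_cast (by omega : i ≤ t)
        omega
    have := le_abs_self (y j - y i)
    simp only
    linarith
  · rw [Finset.card_image_of_injOn, Finset.card_product, Finset.card_range]
    rintro ⟨j, w⟩ hp ⟨i, w'⟩ hp' heq
    simp only [Finset.coe_product, Set.mem_prod, Finset.mem_coe, Finset.mem_range] at hp hp' heq
    have h1 := hW w hp.2 w' hp'.2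
    have h2 := hW w' hp'.2 w hp.2
    -- Distinct `y j` are at least `d` apart and `W` has diameter less than `d`, so the sums are all
    -- different.
    have h3 : |y j - y i| < d := by rw [abs_lt]; constructor <;> linarith
    have hij : i = j := by
      rcases lt_trichotomy i j with hij | hij | hij
      · have h4 := (habs i j hij.le (by omega)).1
        have : (i : ℤ) + 1 ≤ j := by exact_mod_cast hij
        nlinarith
      · exact hij
      · rw [abs_sub_comm] at h3
        have h4 := (habs j i hij.le (by omega)).1
        have : (j : ℤ) + 1 ≤ i := by exact_mod_cast hij
        nlinarith
    subst hij
    simp only [Prod.mk.injEq, true_and]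
    linarith

/-! ### The scales, and the dichotomy at one scale. -/

/-- The lengths of the windows at level `h`. -/
def windowLen (r h : ℕ) : ℕ := 2 * r ^ h

/-- The sizes of the sets of chords at level `h`. -/
def groupSize (r h : ℕ) : ℕ := 4 ^ (h + 1) * windowLen r h

theorem windowLen_succ (r h : ℕ) : windowLen r (h + 1) = r * windowLen r h := by
  simp only [windowLen]; ring

theorem groupSize_succ (r h : ℕ) : groupSize r (h + 1) = 4 * r * groupSize r h := by
  simp only [groupSize, windowLen]; ring

theorem windowLen_pos {r : ℕ} (hr : 0 < r) (h : ℕ) : 0 < windowLen r h := by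
  simp only [windowLen]; positivity

theorem groupSize_pos {r : ℕ} (hr : 0 < r) (h : ℕ) : 0 < groupSize r h := by
  have := windowLen_pos hr h
  simp only [groupSize]; positivity

theorem windowLen_le_groupSize (r h : ℕ) : 4 * windowLen r h ≤ groupSize r h := by
  simp only [groupSize]
  refine Nat.mul_le_mul_right _ ?_
  exact le_self_pow₀ (by norm_num) (by omega)

/-- Every set of chords at level `h + 1` either has a pair of value at least `r ^ h`, or contains
`r` sets of chords at level `h`. -/
theorem split_or_refine {x : ℕ → ℕ} {r h : ℕ} (hr : 0 < r) {G : Finset ℕ}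
    (hG : groupSize r (h + 1) ≤ #G)
    (hw : ∃ c : ℤ, ∀ a ∈ G, c ≤ x a ∧ (x a : ℤ) < c + windowLen r (h + 1)) :
    (∃ δ : ℤ, EvenVal x G δ ∧ (r : ℤ) ^ h ≤ |δ| ∧ |δ| < 2 * windowLen r (h + 1)) ∨
      ∃ F, IsFamily x (windowLen r h) (groupSize r h) F ∧ #F = r ∧ ∀ H ∈ F, H ⊆ G := by
  obtain ⟨c, hc⟩ := hw
  have hq1 := windowLen_pos hr (h + 1)
  have hq4 := windowLen_le_groupSize r (h + 1)
  have hqr : windowLen r (h + 1) = 2 * r ^ (h + 1) := rfl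
  have hrpos : 1 ≤ r ^ (h + 1) := Nat.one_le_pow _ _ hr
  -- Half of the guaranteed size lies below the cut and will serve for the subgroups; the other half
  -- exceeds the gap, so some chord `p'` lies above it.
  obtain ⟨t, ht, hcard⟩ := exists_cut G (2 * r * groupSize r h) (windowLen r (h + 1))
    (by rw [groupSize_succ] at hG; linarith)
  have hge := groupSize_succ r h
  obtain ⟨p', hp'⟩ : {a ∈ G | t + windowLen r (h + 1) ≤ a}.Nonempty := by
    rw [← Finset.card_pos]
    by_contra hcon
    have hz : #{a ∈ G | t + windowLen r (h + 1) ≤ a} = 0 := by omega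
    rw [hz] at hcard
    have : 2 * (2 * r * groupSize r h) = groupSize r (h + 1) := by rw [hge]; ring
    omega
  rw [Finset.mem_filter] at hp'
  -- If no `p` below the cut forms a large pair with `p'`, all lengths there are within `r ^ h` of
  -- `x p' + 2`, hence in one window of length `2 * r ^ h`. This explains the factor `2` in
  -- `windowLen`.
  by_cases hs : ∃ p ∈ {a ∈ G | a < t}, (r : ℤ) ^ h ≤ |(x p' : ℤ) - x p + 2|
  · left
    obtain ⟨p, hp, hδ⟩ := hs
    rw [Finset.mem_filter] at hp
    refine ⟨_, EvenVal.pair (Finset.mem_coe.2 hp.1) (Finset.mem_coe.2 hp'.1)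
      (prec_of_window (hc p hp.1) (hc p' hp'.1) (by omega)), hδ, ?_⟩
    have h1 := hc p hp.1
    have h2 := hc p' hp'.1
    rw [abs_lt]
    constructor <;> omega
  · right
    push Not at hs
    obtain ⟨F, hF, hcF, hFS⟩ := exists_isFamily_of_window (x := x) (q := windowLen r h)
      (g := groupSize r h) (N := r) (c := (x p' : ℤ) + 2 - (r : ℤ) ^ h + 1) (groupSize_pos hr h)
      (S := {a ∈ G | a < t})
      (by
        rw [ht]
        have := windowLen_le_groupSize r h
        have : r * windowLen r h ≤ r * groupSize r h := Nat.mul_le_mul_left _ (by omega)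
        linarith)
      (by
        intro a ha
        have := abs_lt.1 (hs a ha)
        have h2 : ((windowLen r h : ℕ) : ℤ) = 2 * (r : ℤ) ^ h := by simp [windowLen]
        rw [h2]
        constructor <;> linarith [this.1, this.2])
    exact ⟨F, hF, hcF, fun H hH => (hFS H hH).trans (Finset.filter_subset _ _)⟩

/-- Pigeonhole over `r` subwindows. It brings groups down one level when their own large pairs are
not used. -/
theorem exists_child {x : ℕ → ℕ} {r h : ℕ} (hr : 0 < r) {G : Finset ℕ}
    (hG : groupSize r (h + 1) ≤ #G)
    (hw : ∃ c : ℤ, ∀ a ∈ G, c ≤ x a ∧ (x a : ℤ) < c + windowLen r (h + 1)) :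
    ∃ F, IsFamily x (windowLen r h) (groupSize r h) F ∧ #F = 1 ∧ ∀ H ∈ F, H ⊆ G := by
  obtain ⟨c, hc⟩ := hw
  obtain ⟨G', hG', hcard, hw'⟩ := exists_subset_window (x := x) (r := r) (q := windowLen r h)
    (g := groupSize r h) (c := c) (G := G) hr (windowLen_pos hr h)
    (by rw [groupSize_succ] at hG; nlinarith) (by rwa [← windowLen_succ])
  refine ⟨{G'}, ⟨?_, ?_, ?_⟩, by simp, by simpa using hG'⟩
  · simpa using hcard
  · simpa using hw'
  · intro A hA B hB hne
    simp only [Finset.mem_singleton] at hA hB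
    exact absurd (hA.trans hB.symm) hne

/-- Pigeonhole over `2 * L` classes given by sign and dyadic size; the `+ 1` absorbs the rounding.
-/
theorem exists_dyadic_class {ι : Type*} [DecidableEq ι] (δ : ι → ℤ) (L : ℕ) (S : Finset ι)
    (hL : 0 < L) (h : ∀ i ∈ S, 0 < |δ i| ∧ |δ i| < 2 ^ L) :
    ∃ E ⊆ S, #S ≤ 2 * L * (#E + 1) ∧ ∃ (k : ℕ) (σ : ℤ), (σ = 1 ∨ σ = -1) ∧
      ∀ i ∈ E, (2 : ℤ) ^ k ≤ σ * δ i ∧ σ * δ i < 2 * 2 ^ k ∧ |δ i| = σ * δ i := by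
  classical
  obtain ⟨⟨b, k⟩, -, hy⟩ := Finset.exists_le_card_fiber_of_mul_le_card_of_maps_to
    (s := S) (t := (Finset.univ : Finset Bool) ×ˢ Finset.range L)
    (f := fun i => (decide (0 < δ i), Nat.log 2 (δ i).natAbs)) (n := #S / (2 * L))
    (by
      intro i hi
      have h1 := h i hi
      simp only [Finset.mem_product, Finset.mem_univ, true_and, Finset.mem_range]
      refine Nat.log_lt_of_lt_pow ?_ ?_
      · have := Int.natAbs_pos.2 (abs_pos.1 h1.1); omega
      · have : ((δ i).natAbs : ℤ) < 2 ^ L := by rw [Int.natCast_natAbs]; exact h1.2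
        exact_mod_cast this)
    (by simpa using hL.ne')
    (by simpa using Nat.mul_div_le #S (2 * L))
  refine ⟨{i ∈ S | (decide (0 < δ i), Nat.log 2 (δ i).natAbs) = (b, k)},
    Finset.filter_subset _ _, ?_, k, if b then 1 else -1, by split_ifs <;> simp, ?_⟩
  · have := Nat.lt_mul_div_succ #S (show 0 < 2 * L by omega)
    calc #S ≤ 2 * L * (#S / (2 * L) + 1) := this.le
      _ ≤ _ := Nat.mul_le_mul_left _ (by omega)
  · intro i hi
    obtain ⟨hi, hb⟩ := Finset.mem_filter.1 hi
    simp only [Prod.mk.injEq] at hb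
    have h0 : (δ i).natAbs ≠ 0 := Int.natAbs_ne_zero.2 (abs_pos.1 (h i hi).1)
    have h1 : (2 : ℕ) ^ k ≤ (δ i).natAbs := by rw [← hb.2]; exact Nat.pow_log_le_self 2 h0
    have h2 : (δ i).natAbs < 2 ^ k * 2 := by
      rw [← pow_succ, ← hb.2]; exact Nat.lt_pow_succ_log_self (by norm_num) _
    have h1' : (2 : ℤ) ^ k ≤ |δ i| := by rw [← Int.natCast_natAbs]; exact_mod_cast h1
    have h2' : |δ i| < 2 ^ k * 2 := by rw [← Int.natCast_natAbs]; exact_mod_cast h2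
    have h3 : |δ i| = (if b then 1 else -1) * δ i := by
      cases hbb : b
      · have : ¬ 0 < δ i := by rw [hbb] at hb; simpa using hb.1
        simp [abs_of_nonpos (not_lt.1 this)]
      · have : 0 < δ i := by rw [hbb] at hb; simpa using hb.1
        simp [abs_of_pos this]
    rw [← h3]
    exact ⟨h1', by linarith, rfl⟩

/-! ### Filling an interval with values of even chains. -/

/-- The values of the family `F` fill an interval of length `w` up to the factor `C`. -/
def Fills (x : ℕ → ℕ) (F : Finset (Finset ℕ)) (C w : ℕ) : Prop :=
  ∃ W : Finset ℤ, 0 ∈ W ∧ (∀ z ∈ W, FamVal x F z) ∧ (∀ z ∈ W, ∀ z' ∈ W, z - z' < w) ∧ w ≤ C * #W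

theorem Fills.mono {x : ℕ → ℕ} {F F' : Finset (Finset ℕ)} {C C' w : ℕ} (h : Fills x F C w)
    (hF : ∀ z, FamVal x F z → FamVal x F' z) (hC : C ≤ C') : Fills x F' C' w := by
  obtain ⟨W, h0, hv, hd, hc⟩ := h
  exact ⟨W, h0, fun z hz => hF z (hv z hz), hd, hc.trans (Nat.mul_le_mul_right _ hC)⟩

theorem fills_singleton_zero (x : ℕ → ℕ) (F : Finset (Finset ℕ)) {C w : ℕ} (hw : 0 < w)
    (hC : w ≤ C) : Fills x F C w :=
  ⟨{0}, by simp, by simpa using famVal_zero x F, by simpa using hw, by simpa using hC⟩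

/-- Pairs of value about `d` in the members of `E` extend a filling of an interval of length `d`
to a filling of an interval of length `w`. -/
theorem Fills.extend {x : ℕ → ℕ} {F E : Finset (Finset ℕ)} {C w d : ℕ} (hF : Fills x F C d)
    (hFE : Disjoint E F) (hd : 0 < d) (hdw : 2 * d ≤ w) {δ : Finset ℕ → ℤ} {σ : ℤ}
    (hσ : σ = 1 ∨ σ = -1) (hδ : ∀ G ∈ E, EvenVal x G (δ G))
    (hδd : ∀ G ∈ E, (d : ℤ) ≤ σ * δ G ∧ σ * δ G < 2 * d) (hE : w / (2 * d) - 1 ≤ #E) :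
    Fills x (E ∪ F) (4 * C) w := by
  obtain ⟨W, h0, hv, hdiam, hcard⟩ := hF
  obtain ⟨U, hU, hU0, -, hstep⟩ := exists_subset_sums δ d σ E hδd
  -- With `t` steps the diameter is below `2 * d * t + d ≤ 2 * d * (t + 1) ≤ w`, while `w < 2 * d *
  -- (t + 2) ≤ 4 * d * (t + 1)`; hence the factor `4`.
  set t := w / (2 * d) - 1 with ht
  obtain ⟨W', h0', hW', hdiam', hcard'⟩ := exists_sumset_of_steps (t := t)
    (y := fun j => ∑ i ∈ U j, δ i) hσ (by exact_mod_cast hd)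
    (fun j hj => hstep j (hj.trans_le hE)) (by simp [hU0]) h0 hdiam
  have hk : 1 ≤ w / (2 * d) := (Nat.one_le_div_iff (by omega)).2 hdw
  have hk1 : 2 * d * (w / (2 * d)) ≤ w := Nat.mul_div_le _ _
  have hk2 : w < 2 * d * (w / (2 * d) + 1) := Nat.lt_mul_div_succ _ (by omega)
  have ht1 : w / (2 * d) = t + 1 := by omega
  rw [ht1] at hk1 hk2
  refine ⟨W', h0', ?_, ?_, ?_⟩
  · intro z hz
    obtain ⟨j, hj, u, hu, rfl⟩ := hW' z hz
    refine FamVal.add ?_ (hv u hu) hFE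
    exact (famVal_sum δ fun G hG => hδ G (hU j hG)).mono (hU j)
  · intro z hz z' hz'
    refine (hdiam' z hz z' hz').trans_le ?_
    have : ((2 * d * (t + 1) : ℕ) : ℤ) ≤ w := by exact_mod_cast hk1
    push_cast at this
    have hd' : (0 : ℤ) < d := by exact_mod_cast hd
    linarith
  · rw [hcard']
    calc w ≤ 2 * d * (t + 1 + 1) := hk2.le
      _ ≤ 2 * d * (2 * (t + 1)) := Nat.mul_le_mul_left _ (by omega)
      _ = 4 * (t + 1) * d := by ring
      _ ≤ 4 * (t + 1) * (C * #W) := Nat.mul_le_mul_left _ hcard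
      _ = _ := by ring

/-- The number of sets of chords at level `h` needed for filling an interval. -/
def groupBound (r L h : ℕ) : ℕ := 8 ^ h * (128 * r ^ 2 * L)

/-- The factor by which the sets of chords at level `h` must outnumber the interval to be
filled. -/
def fillBound (r L h : ℕ) : ℕ := 2 ^ h * (32 * r * L)

theorem fillBound_mul_le_groupBound (r L h : ℕ) :
    4 * r * fillBound r L h ≤ groupBound r L h := by
  have : 2 ^ h ≤ 8 ^ h := Nat.pow_le_pow_left (by norm_num) h
  calc 4 * r * fillBound r L h = 2 ^ h * (128 * r ^ 2 * L) := by simp only [fillBound]; ring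
    _ ≤ _ := Nat.mul_le_mul_right _ this

theorem fills_zero {x : ℕ → ℕ} {r L : ℕ} (hr : 0 < r) (hL : 4 ≤ 2 ^ L)
    {F : Finset (Finset ℕ)} (hF : IsFamily x (windowLen r 0) (groupSize r 0) F) {w : ℕ}
    (hw : 0 < w) (hFw : fillBound r L 0 * w ≤ #F * windowLen r 0) : Fills x F 8 w := by
  have hL1 : 2 ≤ L := by
    by_contra hcon
    have : 2 ^ L ≤ 2 ^ 1 := Nat.pow_le_pow_right (by norm_num) (by omega)
    omega
  have hq : windowLen r 0 = 2 := by simp [windowLen]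
  have hg : groupSize r 0 = 8 := by simp [groupSize, windowLen]
  rw [hq, hg] at hF
  -- Lengths in a window of length `2` differ by at most `1`, so the `+ 2` in the value of a pair
  -- makes it positive. The first and last of eight chords start far enough apart to cross.
  have hex : ∀ G ∈ F, ∃ δ : ℤ, EvenVal x G δ ∧ 1 ≤ δ ∧ δ ≤ 3 := by
    intro G hG
    obtain ⟨c, hc⟩ := hF.window G hG
    have hcard := hF.card G hG
    have hne : G.Nonempty := Finset.card_pos.1 (by omega)
    have hsub : G ⊆ Finset.Icc (G.min' hne) (G.max' hne) := fun a ha =>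
      Finset.mem_Icc.2 ⟨G.min'_le a ha, G.le_max' a ha⟩
    have hle := Finset.card_le_card hsub
    rw [Nat.card_Icc] at hle
    have h1 := hc _ (G.min'_mem hne)
    have h2 := hc _ (G.max'_mem hne)
    refine ⟨_, EvenVal.pair (Finset.mem_coe.2 (G.min'_mem hne)) (Finset.mem_coe.2 (G.max'_mem hne))
      (prec_of_window h1 h2 (by omega)), ?_, ?_⟩ <;> push_cast at h1 h2 <;> omega
  choose! δ hδ hδ1 hδ3 using hex
  obtain ⟨E, hES, hEcard, k, σ, hσ, hEk⟩ := exists_dyadic_class δ L F (by omega) (by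
    intro G hG
    have h1 := hδ1 G hG
    have h3 := hδ3 G hG
    rw [abs_of_pos (by omega)]
    have : (4 : ℤ) ≤ 2 ^ L := by exact_mod_cast hL
    omega)
  rcases E.eq_empty_or_nonempty with rfl | ⟨G₀, hG₀⟩
  · exfalso
    simp only [fillBound, hq] at hFw
    simp only [Finset.card_empty] at hEcard
    have : 1 ≤ r * w := Nat.mul_pos hr hw
    nlinarith
  have hk2 : (2 : ℕ) ^ k ≤ 3 := by
    have h1 := hEk G₀ hG₀
    have h2 := hδ3 G₀ (hES hG₀)
    have h3 := hδ1 G₀ (hES hG₀)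
    rw [← h1.2.2, abs_of_pos (by omega)] at h1
    exact_mod_cast h1.1.trans h2
  -- A power of two not exceeding `3`. So `{0}` fills an interval of length `2 ^ k` up to the factor
  -- `2`, and `Fills.extend` turns this into `8`.
  have hk2' : (2 : ℕ) ^ k ≤ 2 := by
    rcases k with _ | _ | k
    · norm_num
    · norm_num
    · exfalso
      have : 2 ^ 2 ≤ 2 ^ (k + 1 + 1) := Nat.pow_le_pow_right (by norm_num) (by omega)
      omega
  by_cases hdw : 2 * 2 ^ k ≤ w
  · have h := Fills.extend (x := x) (F := ∅) (E := E) (C := 2) (w := w) (d := 2 ^ k) (δ := δ)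
      (fills_singleton_zero x ∅ (by positivity) hk2') (by simp) (by positivity) hdw hσ
      (fun G hG => hδ G (hES hG))
      (fun G hG => ⟨by simpa using (hEk G hG).1, by simpa using (hEk G hG).2.1⟩)
      (by
        have h1 : w / (2 * 2 ^ k) ≤ w := Nat.div_le_self _ _
        have h2 : 32 * L * w ≤ 4 * L * (#E + 1) := by
          simp only [fillBound, hq] at hFw
          have : L * w ≤ r * (L * w) := Nat.le_mul_of_pos_left _ hr
          nlinarith
        have h3 : 8 * w ≤ #E + 1 := by
          have : 4 * L * (8 * w) ≤ 4 * L * (#E + 1) := by linarith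
          exact Nat.le_of_mul_le_mul_left this (by omega)
        omega)
    exact h.mono (fun z hz => hz.mono (by simpa using hES)) (by norm_num)
  · exact fills_singleton_zero x F hw (by omega)

/-- Ensures enough pairs for `Fills.extend`: `e` is the size of the dyadic class, `T` that of the
family, `s = w / (2 * d)`, and `p = r ^ h` is a lower bound for `2 * d`. The factor `r` in
`fillBound` pays for pairs much smaller than the window, the factor `L` for the dyadic pigeonhole.
-/
theorem jumpCount_le {r L w p e T s q : ℕ} (hr : 0 < r) (hL : 0 < L) (hp : 0 < p)
    (hq : q = 2 * r * p) (hs : p * s ≤ w) (hT : 64 * r * L * w ≤ T * q)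
    (hSE : T ≤ 4 * (2 * L * (e + 1)) + 2) : s - 1 ≤ e := by
  have h4 : (2 * r * p) * (32 * L * s) ≤ (2 * r * p) * T := by
    calc (2 * r * p) * (32 * L * s) = 64 * r * L * (p * s) := by ring
      _ ≤ 64 * r * L * w := Nat.mul_le_mul_left _ hs
      _ ≤ T * q := hT
      _ = _ := by rw [hq]; ring
  have h5 : 32 * L * s ≤ T := Nat.le_of_mul_le_mul_left h4 (by positivity)
  by_contra hcon
  have h6 : e + 2 ≤ s := by omega
  have : 32 * L * (e + 2) ≤ 32 * L * s := Nat.mul_le_mul_left _ h6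
  nlinarith

/-- If at least half of the groups have no large pair, each splits into `r` groups one level down,
and the product of number and window length is at most halved. Otherwise, of the groups with a large
pair, one half supplies jumps of a common size `2 ^ k`; the other half is kept in reserve and, by
induction, fills an interval as long as one jump. -/
theorem fills_of_isFamily {x : ℕ → ℕ} {r L : ℕ} (hr : 0 < r) (h : ℕ) :
    2 * windowLen r h ≤ 2 ^ L → ∀ F : Finset (Finset ℕ),
      IsFamily x (windowLen r h) (groupSize r h) F → groupBound r L h ≤ #F → ∀ w : ℕ, 0 < w →
        fillBound r L h * w ≤ #F * windowLen r h → Fills x F (8 * 4 ^ h) w := by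
  induction h with
  | zero =>
    intro hL F hF _ w hw hFw
    simpa using fills_zero hr (by simpa [windowLen] using hL) hF hw hFw
  | succ h ih =>
    intro hL F hF hB w hw hFw
    classical
    have hq := windowLen_succ r h
    have hqpos := windowLen_pos hr h
    have hg := groupSize_pos hr h
    have hL' : 2 * windowLen r h ≤ 2 ^ L := by
      refine le_trans ?_ hL
      rw [hq]
      have : windowLen r h ≤ r * windowLen r h := Nat.le_mul_of_pos_left _ hr
      omega
    have hLpos : 0 < L := by
      rcases Nat.eq_zero_or_pos L with rfl | hLp
      · simp at hL'; omega
      · exact hLp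
    have hBh : groupBound r L (h + 1) = 8 * groupBound r L h := by
      simp only [groupBound]; ring
    have hAh : fillBound r L (h + 1) = 2 * fillBound r L h := by
      simp only [fillBound]; ring
    have hAB := fillBound_mul_le_groupBound r L h
    have hApos : 32 * r * L ≤ fillBound r L h :=
      Nat.le_mul_of_pos_left _ (by positivity)
    have hC : 8 * 4 ^ h ≤ 8 * 4 ^ (h + 1) := by
      have : 4 ^ h ≤ 4 ^ (h + 1) := Nat.pow_le_pow_right (by norm_num) (by omega)
      omega
    obtain ⟨P, hP⟩ : ∃ P : Finset ℕ → Prop, ∀ G, P G ↔ ∃ δ : ℤ, EvenVal x G δ ∧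
      (r : ℤ) ^ h ≤ |δ| ∧ |δ| < 2 * windowLen r (h + 1) := ⟨_, fun _ => Iff.rfl⟩
    have hcardF : #{G ∈ F | P G} + #{G ∈ F | ¬ P G} = #F :=
      Finset.card_filter_add_card_filter_not _
    by_cases hcase : #F ≤ 2 * #{G ∈ F | ¬ P G}
    · have hex : ∀ G ∈ {G ∈ F | ¬ P G}, ∃ F', IsFamily x (windowLen r h) (groupSize r h) F' ∧
          #F' = r ∧ ∀ H ∈ F', H ⊆ G := by
        intro G hG
        obtain ⟨hG, hnP⟩ := Finset.mem_filter.1 hG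
        exact (split_or_refine hr (hF.card G hG) (hF.window G hG)).resolve_left (mt (hP G).2 hnP)
      choose! ch hch using hex
      obtain ⟨hfam, hcard, hval⟩ := IsFamily.refine hg (hF.comp.mono (Finset.filter_subset _ _))
        ch hch
      refine (ih hL' _ hfam ?_ w hw ?_).mono
        (fun z hz => (hval z hz).mono (Finset.filter_subset _ _)) hC
      · rw [hcard]
        have : #{G ∈ F | ¬ P G} ≤ #{G ∈ F | ¬ P G} * r := Nat.le_mul_of_pos_right _ hr
        omega
      · rw [hcard]
        rw [hAh, hq] at hFw
        have : #F * (r * windowLen r h) ≤ 2 * #{G ∈ F | ¬ P G} * (r * windowLen r h) :=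
          Nat.mul_le_mul_right _ hcase
        nlinarith
    · have hSP : #F ≤ 2 * #{G ∈ F | P G} := by omega
      have hex : ∀ G ∈ {G ∈ F | P G}, ∃ δ : ℤ, EvenVal x G δ ∧ (r : ℤ) ^ h ≤ |δ| ∧
          |δ| < 2 * windowLen r (h + 1) := fun G hG => (hP G).1 (Finset.mem_filter.1 hG).2
      choose! δ hδ hδl hδu using hex
      obtain ⟨S₁, hS₁, hS₁card⟩ := Finset.exists_subset_card_eq
        (s := {G ∈ F | P G}) (n := #{G ∈ F | P G} / 2) (Nat.div_le_self _ _)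
      set S₂ := {G ∈ F | P G} \ S₁ with hS₂
      have hS₂F : S₂ ⊆ F := Finset.sdiff_subset.trans (Finset.filter_subset _ _)
      have hS₂card : #S₂ = #{G ∈ F | P G} - #S₁ := Finset.card_sdiff_of_subset hS₁
      have hex2 : ∀ G ∈ S₂, ∃ F', IsFamily x (windowLen r h) (groupSize r h) F' ∧
          #F' = 1 ∧ ∀ H ∈ F', H ⊆ G := by
        intro G hG
        exact exists_child hr (hF.card G (hS₂F hG)) (hF.window G (hS₂F hG))
      choose! ch hch using hex2
      obtain ⟨hfam, hcard, hval⟩ := IsFamily.refine hg (hF.comp.mono hS₂F) ch hch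
      rw [mul_one] at hcard
      have hS₂F4 : #F ≤ 4 * #S₂ := by omega
      have hBS₂ : groupBound r L h ≤ #S₂ := by omega
      -- This range covers the jump size `2 ^ k < 2 * windowLen r (h + 1)` and also any `w < 2 * 2 ^
      -- k`, for which no jump is needed. `groupBound` is large enough for the reserve to reach that
      -- far.
      have hIH : ∀ d : ℕ, 0 < d → d ≤ 4 * windowLen r (h + 1) → Fills x S₂ (8 * 4 ^ h) d := by
        intro d hd hdle
        refine (ih hL' _ hfam (by rw [hcard]; exact hBS₂) d hd ?_).mono hval le_rfl
        rw [hcard]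
        calc fillBound r L h * d ≤ fillBound r L h * (4 * windowLen r (h + 1)) :=
              Nat.mul_le_mul_left _ hdle
          _ = (4 * r * fillBound r L h) * windowLen r h := by rw [hq]; ring
          _ ≤ #S₂ * windowLen r h := Nat.mul_le_mul_right _ (hAB.trans hBS₂)
      obtain ⟨E, hES, hEcard, k, σ, hσ, hEk⟩ := exists_dyadic_class δ L S₁ hLpos (by
        intro G hG
        have h1 := hδl G (hS₁ hG)
        have h2 := hδu G (hS₁ hG)
        have h3 : (0 : ℤ) < (r : ℤ) ^ h := by positivity
        have h4 : ((2 * windowLen r (h + 1) : ℕ) : ℤ) ≤ ((2 ^ L : ℕ) : ℤ) := by exact_mod_cast hL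
        push_cast at h4
        exact ⟨by omega, by omega⟩)
      have hT8 : 32 * r * L * 32 * r ≤ #F := by
        have h8 : 1 ≤ 8 ^ h := Nat.one_le_pow _ _ (by norm_num)
        have : 128 * r ^ 2 * L ≤ groupBound r L h := Nat.le_mul_of_pos_left _ (by omega)
        rw [hBh] at hB
        nlinarith
      have hSE : #F ≤ 4 * (2 * L * (#E + 1)) + 2 := by omega
      have hEne : E.Nonempty := by
        rw [Finset.nonempty_iff_ne_empty]
        rintro rfl
        simp only [Finset.card_empty] at hSE
        have : L ≤ L * (r * r) := Nat.le_mul_of_pos_right _ (by positivity)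
        nlinarith
      obtain ⟨G₀, hG₀⟩ := hEne
      have hG₀S := hS₁ (hES hG₀)
      have hkup : 2 ^ k < 2 * windowLen r (h + 1) := by
        have h1 := (hEk G₀ hG₀).1
        rw [← (hEk G₀ hG₀).2.2] at h1
        exact_mod_cast h1.trans_lt (hδu G₀ hG₀S)
      have hklow : r ^ h < 2 * 2 ^ k := by
        have h1 := (hEk G₀ hG₀).2.1
        rw [← (hEk G₀ hG₀).2.2] at h1
        exact_mod_cast (hδl G₀ hG₀S).trans_lt h1
      by_cases hdw : 2 * 2 ^ k ≤ w
      · have hlast := Fills.extend (x := x) (F := S₂) (E := E) (C := 8 * 4 ^ h) (w := w)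
          (d := 2 ^ k) (δ := δ) (hIH _ (by positivity) (by omega))
          (Finset.disjoint_of_subset_left hES Finset.disjoint_sdiff) (by positivity) hdw hσ
          (fun G hG => hδ G (hS₁ (hES hG)))
          (fun G hG => ⟨by simpa using (hEk G hG).1, by simpa using (hEk G hG).2.1⟩)
          (by
            refine jumpCount_le (p := r ^ h) (w := w) hr hLpos (by positivity)
              (show windowLen r (h + 1) = 2 * r * r ^ h by simp only [windowLen]; ring) ?_ ?_ hSE
            · exact (Nat.mul_le_mul_right _ hklow.le).trans (Nat.mul_div_le _ _)
            · refine le_trans (Nat.mul_le_mul_right _ ?_) hFw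
              rw [hAh]; linarith)
        refine hlast.mono (fun z hz => hz.mono ?_) (by rw [pow_succ]; linarith)
        exact Finset.union_subset ((hES.trans hS₁).trans (Finset.filter_subset _ _)) hS₂F
      · exact (hIH w hw (by omega)).mono (fun z hz => hz.mono hS₂F) hC

/-! ### Odd chains: heavy and light cells of chord lengths. -/

/-- The values of chains of odd length for `Prec` in `S`. -/
def OddVal (x : ℕ → ℕ) (S : Set ℕ) (z : ℤ) : Prop :=
  ∃ e ∈ S, ∃ S' ⊆ S, ∃ z', EvenVal x S' z' ∧ (∀ y ∈ S', Prec x y e) ∧ z = z' - x e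

theorem OddVal.mono {x : ℕ → ℕ} {S T : Set ℕ} {z : ℤ} (h : OddVal x S z) (hST : S ⊆ T) :
    OddVal x T z := by
  obtain ⟨e, he, S', hS', h⟩ := h
  exact ⟨e, hST he, S', hS'.trans hST, h⟩

theorem oddVal_single {x : ℕ → ℕ} {S : Set ℕ} {e : ℕ} (he : e ∈ S) : OddVal x S (-(x e : ℤ)) :=
  ⟨e, he, ∅, Set.empty_subset _, 0, .nil _, by simp, by simp⟩

/-- The number of chords that makes a window at level `h` heavy. -/
def heavyBound (r L h : ℕ) : ℕ :=
  groupBound r L h * (groupSize r h + windowLen r h) + windowLen r h + 1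

/-- The chords below a cut fill an interval with values of even chains, and one fixed chord `e`
above the cut closes every chain. As `0` is among the even values, these are smaller than `windowLen
r h` in absolute value, which localizes `-z` near the window. -/
theorem exists_oddVal_of_heavy {x : ℕ → ℕ} {r L h : ℕ} (hr : 0 < r)
    (hL : 2 * windowLen r h ≤ 2 ^ L) {S : Finset ℕ} {c : ℤ}
    (hw : ∀ a ∈ S, c ≤ x a ∧ (x a : ℤ) < c + windowLen r h) (hS : heavyBound r L h ≤ #S) :
    ∃ W : Finset ℤ, (∀ z ∈ W, OddVal x S z ∧ c - windowLen r h < -z ∧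
      -z < c + 2 * windowLen r h) ∧ windowLen r h ≤ 8 * 4 ^ h * #W := by
  have hq := windowLen_pos hr h
  obtain ⟨t, ht, hcard⟩ := exists_cut S (groupBound r L h * (groupSize r h + windowLen r h))
    (windowLen r h) (by unfold heavyBound at hS; omega)
  obtain ⟨e, he⟩ : {a ∈ S | t + windowLen r h ≤ a}.Nonempty := by
    rw [← Finset.card_pos]
    unfold heavyBound at hS
    omega
  rw [Finset.mem_filter] at he
  obtain ⟨F, hF, hFcard, hFS⟩ := exists_isFamily_of_window (x := x) (groupSize_pos hr h)
    (S := {a ∈ S | a < t}) ht.ge (fun a ha => hw a (Finset.filter_subset _ _ ha))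
  obtain ⟨W, h0, hv, hd, hc⟩ := fills_of_isFamily hr h hL F hF hFcard.ge (windowLen r h) hq (by
    rw [hFcard]
    refine Nat.mul_le_mul_right _ ((Nat.le_mul_of_pos_left _ ?_).trans
      (fillBound_mul_le_groupBound r L h))
    omega)
  refine ⟨W.image fun z => z - x e, ?_, ?_⟩
  · intro z hz
    obtain ⟨z', hz', rfl⟩ := Finset.mem_image.1 hz
    have h1 := hd z' hz' 0 h0
    have h2 := hd 0 h0 z' hz'
    have h3 := hw e he.1
    refine ⟨⟨e, he.1, {a | ∃ G ∈ F, a ∈ G}, ?_, z', (hv z' hz').evenVal hF.comp, ?_, rfl⟩,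
      by omega, by omega⟩
    · rintro a ⟨G, hG, ha⟩
      exact Finset.filter_subset _ _ (hFS G hG ha)
    · rintro a ⟨G, hG, ha⟩
      have := Finset.mem_filter.1 (hFS G hG ha)
      exact prec_of_window (hw a this.1) h3 (by omega)
  · rwa [Finset.card_image_of_injective _ (fun a b hab => by simpa using hab)]

theorem exists_large_fiber {α β : Type*} [DecidableEq β] {s : Finset α} {t : Finset β} {f : α → β}
    (hf : ∀ a ∈ s, f a ∈ t) (ht : t.Nonempty) : ∃ y ∈ t, #s ≤ #t * #{a ∈ s | f a = y} := by
  obtain ⟨y, hy, hmax⟩ := Finset.exists_max_image t (fun y => #{a ∈ s | f a = y}) ht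
  refine ⟨y, hy, ?_⟩
  rw [mul_comm]
  exact Finset.card_le_mul_card_image_of_maps_to hf _ hmax

/-- The factor lost between the number of chords and the number of values. -/
def lossFactor (r L k : ℕ) : ℕ :=
  (k + 1) * (3 * (8 ^ k * 4 ^ (k + 2) * (128 * r ^ 3 * L)) * (8 * 4 ^ k))

/-- A cell that is light at level `h + 1` has few chords compared with the number of values from a
heavy cell at level `h`; the ratio is bounded independently of `h`. -/
theorem heavyBound_succ_le {r L h k : ℕ} (hr : 0 < r) (hL : 0 < L) (hk : h < k) :
    heavyBound r L (h + 1) ≤ 8 ^ k * 4 ^ (k + 2) * (128 * r ^ 3 * L) * windowLen r h := by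
  have h8 : 8 ^ (h + 1) ≤ 8 ^ k := Nat.pow_le_pow_right (by norm_num) hk
  have h4 : 4 ^ (h + 3) ≤ 4 ^ (k + 2) := Nat.pow_le_pow_right (by norm_num) (by omega)
  have hq := windowLen_pos hr (h + 1)
  have hB : 1 ≤ groupBound r L (h + 1) := by
    have : 0 < groupBound r L (h + 1) := by simp only [groupBound]; positivity
    omega
  have h40 : 1 ≤ 4 ^ h := Nat.one_le_pow _ _ (by norm_num)
  calc heavyBound r L (h + 1)
      ≤ groupBound r L (h + 1) * (groupSize r (h + 1) + windowLen r (h + 1)) +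
        groupBound r L (h + 1) * windowLen r (h + 1) +
        groupBound r L (h + 1) * windowLen r (h + 1) := by
        unfold heavyBound
        have h1 : windowLen r (h + 1) ≤ groupBound r L (h + 1) * windowLen r (h + 1) :=
          Nat.le_mul_of_pos_left _ hB
        omega
    _ = groupBound r L (h + 1) * (4 ^ (h + 2) + 3) * windowLen r (h + 1) := by
        simp only [groupSize]; ring
    _ ≤ groupBound r L (h + 1) * 4 ^ (h + 3) * windowLen r (h + 1) := by
        refine Nat.mul_le_mul_right _ (Nat.mul_le_mul_left _ ?_)
        rw [pow_add, pow_add]; omega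
    _ = 8 ^ (h + 1) * 4 ^ (h + 3) * (128 * r ^ 3 * L) * windowLen r h := by
        rw [windowLen_succ]; simp only [groupBound]; ring
    _ ≤ _ := by gcongr

theorem heavyBound_zero_le {r L k : ℕ} (hr : 0 < r) (hL : 0 < L) :
    heavyBound r L 0 ≤ 8 ^ k * 4 ^ (k + 2) * (128 * r ^ 3 * L) := by
  have h1 : 1 ≤ r ^ 2 * L := Nat.mul_pos (by positivity) hL
  have h2 : r ^ 2 * L ≤ r ^ 3 * L :=
    Nat.mul_le_mul_right _ (Nat.pow_le_pow_right hr (by norm_num))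
  have h8 : 1 ≤ 8 ^ k := Nat.one_le_pow _ _ (by norm_num)
  have h4 : 4 ^ 2 ≤ 4 ^ (k + 2) := Nat.pow_le_pow_right (by norm_num) (by omega)
  calc heavyBound r L 0 = 1280 * (r ^ 2 * L) + 3 := by
        simp only [heavyBound, groupBound, groupSize, windowLen]; ring
    _ ≤ 1 * 4 ^ 2 * (128 * r ^ 3 * L) := by linarith
    _ ≤ _ := by gcongr

/-- The cell of `x a` cannot be heavy at level `k`, since `#P ≤ windowLen r k < heavyBound r L k`.
So it is light at level `0` or passes from heavy to light somewhere. -/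
theorem exists_level {x : ℕ → ℕ} {r L k : ℕ} {P : Finset ℕ} (hP : #P ≤ windowLen r k) (a : ℕ) :
    ∃ l ∈ Finset.range (k + 1),
      (l = 0 → #{b ∈ P | x b / windowLen r 0 = x a / windowLen r 0} ≤ heavyBound r L 0) ∧
      ∀ h, l = h + 1 → heavyBound r L h ≤ #{b ∈ P | x b / windowLen r h = x a / windowLen r h} ∧
        #{b ∈ P | x b / windowLen r (h + 1) = x a / windowLen r (h + 1)} ≤
          heavyBound r L (h + 1) := by
  by_contra hcon
  push Not at hcon
  have hall : ∀ h ≤ k,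
      heavyBound r L h < #{b ∈ P | x b / windowLen r h = x a / windowLen r h} := by
    intro h hhk
    induction h with
    | zero =>
      by_contra hlt
      obtain ⟨h, h1, -⟩ := hcon 0 (by simp) (fun _ => by omega)
      omega
    | succ h ih =>
      by_contra hlt
      obtain ⟨h', h1, h2⟩ := hcon (h + 1) (by simp; omega) (fun h => by omega)
      obtain rfl : h = h' := by omega
      have := h2 (ih (by omega)).le
      omega
  have h1 := hall k le_rfl
  have h2 := Finset.card_filter_le P (fun b => x b / windowLen r k = x a / windowLen r k)
  unfold heavyBound at h1
  omega

/-- The values of a cell spill over by less than one window on either side, so cells congruent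
modulo `3` have disjoint sets of values. -/
theorem exists_oddVal_of_cells {x : ℕ → ℕ} {r L h : ℕ} (hr : 0 < r)
    (hL : 2 * windowLen r h ≤ 2 ^ L) {P : Finset ℕ} (Y : Finset ℕ)
    (hY : ∀ y ∈ Y, heavyBound r L h ≤ #{b ∈ P | x b / windowLen r h = y}) :
    ∃ Λ : Finset ℤ, (∀ z ∈ Λ, OddVal x P z) ∧ #Y * windowLen r h ≤ 3 * (8 * 4 ^ h) * #Λ := by
  classical
  have hq := windowLen_pos hr h
  obtain ⟨i, -, hi⟩ := exists_large_fiber (s := Y) (t := Finset.range 3) (f := fun y => y % 3)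
    (fun y _ => Finset.mem_range.2 (Nat.mod_lt _ (by norm_num))) (by simp)
  rw [Finset.card_range] at hi
  set Y' := {y ∈ Y | y % 3 = i} with hY'
  have hex : ∀ y ∈ Y', ∃ W : Finset ℤ, (∀ z ∈ W, OddVal x P z ∧
      ((y * windowLen r h : ℕ) : ℤ) - windowLen r h < -z ∧
      -z < ((y * windowLen r h : ℕ) : ℤ) + 2 * windowLen r h) ∧
      windowLen r h ≤ 8 * 4 ^ h * #W := by
    intro y hy
    obtain ⟨W, hW, hWc⟩ := exists_oddVal_of_heavy (x := x) hr hL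
      (c := ((y * windowLen r h : ℕ) : ℤ))
      (S := {b ∈ P | x b / windowLen r h = y}) (by
        intro a ha
        have ha := (Finset.mem_filter.1 ha).2
        rw [Nat.div_eq_iff hq] at ha
        exact ⟨by exact_mod_cast ha.1, by exact_mod_cast (by omega)⟩)
      (hY y (Finset.mem_filter.1 hy).1)
    refine ⟨W, fun z hz => ⟨(hW z hz).1.mono ?_, (hW z hz).2⟩, hWc⟩
    exact_mod_cast Finset.filter_subset _ _
  choose! W hW hWc using hex
  refine ⟨Y'.biUnion W, ?_, ?_⟩
  · intro z hz
    obtain ⟨y, hy, hz⟩ := Finset.mem_biUnion.1 hz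
    exact (hW y hy z hz).1
  · rw [Finset.card_biUnion]
    · have h1 : #Y' * windowLen r h ≤ 8 * 4 ^ h * ∑ y ∈ Y', #(W y) := by
        rw [Finset.mul_sum, ← smul_eq_mul, ← Finset.sum_const]
        exact Finset.sum_le_sum hWc
      calc #Y * windowLen r h ≤ 3 * #Y' * windowLen r h := Nat.mul_le_mul_right _ hi
        _ = 3 * (#Y' * windowLen r h) := by ring
        _ ≤ 3 * (8 * 4 ^ h * ∑ y ∈ Y', #(W y)) := Nat.mul_le_mul_left _ h1
        _ = _ := by ring
    · have key : ∀ y ∈ Y', ∀ y' ∈ Y', y < y' → Disjoint (W y) (W y') := by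
        intro y hy y' hy' hlt
        rw [Finset.disjoint_left]
        intro z hz hz'
        have h1 := (hW y hy z hz).2.2
        have h2 := (hW y' hy' z hz').2.1
        have h3 : y + 3 ≤ y' := by
          have := (Finset.mem_filter.1 hy).2
          have := (Finset.mem_filter.1 hy').2
          omega
        have h4 : (y + 3) * windowLen r h ≤ y' * windowLen r h := Nat.mul_le_mul_right _ h3
        have h5 : (((y + 3) * windowLen r h : ℕ) : ℤ) ≤ ((y' * windowLen r h : ℕ) : ℤ) := by
          exact_mod_cast h4
        push_cast at h1 h2 h5
        linarith
      intro y hy y' hy' hne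
      rcases lt_or_gt_of_ne hne with hlt | hlt
      · exact key y hy y' hy' hlt
      · exact (key y' hy' y hy hlt).symm

/-- A proportion `1 / (k + 1)` of the chords share a level. At level `0` no length is repeated
often, so single chords suffice. At level `h + 1`, each heavy cell of level `h` accounts for a
bounded number of these chords, so there are many such cells. -/
theorem exists_oddVal {x : ℕ → ℕ} {r L k : ℕ} (hr : 0 < r) (hL : 2 * windowLen r k ≤ 2 ^ L)
    {P : Finset ℕ} (hP : #P ≤ windowLen r k) :
    ∃ Λ : Finset ℤ, (∀ z ∈ Λ, OddVal x P z) ∧ #P ≤ lossFactor r L k * #Λ := by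
  classical
  have hLpos : 0 < L := by
    have := windowLen_pos hr k
    rcases Nat.eq_zero_or_pos L with rfl | hLp
    · simp at hL; omega
    · exact hLp
  have hex := exists_level (x := x) (L := L) hP
  choose lev hlev hlev0 hlevs using hex
  obtain ⟨l, hl, hcard⟩ := exists_large_fiber (s := P) (f := lev) (fun a _ => hlev a) (by simp)
  rw [Finset.card_range] at hcard
  set Pl := {a ∈ P | lev a = l} with hPl
  set D := 8 ^ k * 4 ^ (k + 2) * (128 * r ^ 3 * L) with hD
  have hfin : ∀ Λ : Finset ℤ, #Pl ≤ 3 * D * (8 * 4 ^ k) * #Λ → #P ≤ lossFactor r L k * #Λ := by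
    intro Λ hΛ
    calc #P ≤ (k + 1) * #Pl := hcard
      _ ≤ (k + 1) * (3 * D * (8 * 4 ^ k) * #Λ) := Nat.mul_le_mul_left _ hΛ
      _ = _ := by simp only [lossFactor, hD]; ring
  have h4k : 1 ≤ 4 ^ k := Nat.one_le_pow _ _ (by norm_num)
  rcases l with _ | h
  · refine ⟨Pl.image fun a => -(x a : ℤ), ?_, hfin _ ?_⟩
    · intro z hz
      obtain ⟨a, ha, rfl⟩ := Finset.mem_image.1 hz
      exact oddVal_single (Finset.mem_coe.2 (Finset.filter_subset _ _ ha))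
    · have h1 : #Pl ≤ heavyBound r L 0 * #(Pl.image fun a => -(x a : ℤ)) := by
        refine Finset.card_le_mul_card_image _ _ ?_
        intro z hz
        obtain ⟨a, ha, rfl⟩ := Finset.mem_image.1 hz
        refine le_trans (Finset.card_le_card ?_) (hlev0 a (Finset.mem_filter.1 ha).2)
        intro b hb
        obtain ⟨hb, hba⟩ := Finset.mem_filter.1 hb
        have : x b = x a := by simpa using hba
        exact Finset.mem_filter.2 ⟨Finset.filter_subset _ _ hb, by rw [this]⟩
      refine h1.trans (Nat.mul_le_mul_right _ ?_)
      calc heavyBound r L 0 ≤ D * 1 := by simpa using heavyBound_zero_le hr hLpos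
        _ ≤ D * (24 * 4 ^ k) := Nat.mul_le_mul_left _ (by omega)
        _ = _ := by ring
  · have hhk : h < k := by simpa using hl
    have hqh := windowLen_pos hr h
    have hLh : 2 * windowLen r h ≤ 2 ^ L := by
      refine le_trans (Nat.mul_le_mul_left _ ?_) hL
      simp only [windowLen]
      exact Nat.mul_le_mul_left _ (Nat.pow_le_pow_right hr hhk.le)
    set Y := Pl.image fun a => x a / windowLen r h with hY
    obtain ⟨Λ, hΛ, hΛc⟩ := exists_oddVal_of_cells (x := x) hr hLh (P := P) Y (by
      intro y hy
      obtain ⟨a, ha, rfl⟩ := Finset.mem_image.1 hy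
      exact (hlevs a h (Finset.mem_filter.1 ha).2).1)
    refine ⟨Λ, hΛ, hfin Λ ?_⟩
    have h1 : #Pl ≤ heavyBound r L (h + 1) * #Y := by
      refine Finset.card_le_mul_card_image _ _ ?_
      intro y hy
      obtain ⟨a, ha, rfl⟩ := Finset.mem_image.1 hy
      refine le_trans (Finset.card_le_card ?_) (hlevs a h (Finset.mem_filter.1 ha).2).2
      intro b hb
      obtain ⟨hb, hba⟩ := Finset.mem_filter.1 hb
      refine Finset.mem_filter.2 ⟨Finset.filter_subset _ _ hb, ?_⟩
      rw [windowLen_succ, mul_comm r, ← Nat.div_div_eq_div_mul, ← Nat.div_div_eq_div_mul, hba]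
    have h4 : 4 ^ h ≤ 4 ^ k := Nat.pow_le_pow_right (by norm_num) hhk.le
    calc #Pl ≤ D * windowLen r h * #Y :=
          h1.trans (Nat.mul_le_mul_right _ (heavyBound_succ_le hr hLpos hhk))
      _ = D * (#Y * windowLen r h) := by ring
      _ ≤ D * (3 * (8 * 4 ^ h) * #Λ) := Nat.mul_le_mul_left _ hΛc
      _ ≤ D * (3 * (8 * 4 ^ k) * #Λ) := by gcongr
      _ = _ := by ring

/-! ### Zigzag paths along chains of crossing chords. -/

/-- There is a path of length `k` from `f i` to `f j` with all its vertices in the image of `S`. -/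
def HasPath {V : Type*} (G : SimpleGraph V) (f : ℕ → V) (S : Set ℕ) (i j k : ℕ) : Prop :=
  ∃ p : G.Walk (f i) (f j), p.IsPath ∧ p.length = k ∧ ∀ v ∈ p.support, ∃ m ∈ S, f m = v

/-- The vertices `f 0, …, f (n - 1)` are distinct and consecutive ones are adjacent. -/
structure IsSpine {V : Type*} (G : SimpleGraph V) (f : ℕ → V) (n : ℕ) : Prop where
  inj : ∀ i < n, ∀ j < n, f i = f j → i = j
  adj : ∀ i, i + 1 < n → G.Adj (f i) (f (i + 1))

section

variable {V : Type*} {G : SimpleGraph V} {f : ℕ → V} {n : ℕ}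

theorem HasPath.mono {S T : Set ℕ} {i j k : ℕ} (h : HasPath G f S i j k) (hST : S ⊆ T) :
    HasPath G f T i j k := by
  obtain ⟨p, hp, hk, hs⟩ := h
  refine ⟨p, hp, hk, fun v hv => ?_⟩
  obtain ⟨m, hm, hmv⟩ := hs v hv
  exact ⟨m, hST hm, hmv⟩

theorem HasPath.cons (hf : IsSpine G f n) {S : Set ℕ} {i i' j k : ℕ}
    (h : HasPath G f S i' j k) (hadj : G.Adj (f i) (f i')) (hi : i < n) (hS : ∀ m ∈ S, m < n)
    (hiS : i ∉ S) : HasPath G f (insert i S) i j (k + 1) := by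
  obtain ⟨p, hp, hk, hs⟩ := h
  refine ⟨.cons hadj p, ?_, by simp [hk], ?_⟩
  · rw [SimpleGraph.Walk.cons_isPath_iff]
    refine ⟨hp, fun hmem => ?_⟩
    obtain ⟨m, hm, hmi⟩ := hs _ hmem
    exact hiS (hf.inj m (hS m hm) i hi hmi ▸ hm)
  · intro v hv
    rw [SimpleGraph.Walk.support_cons, List.mem_cons] at hv
    rcases hv with rfl | hv
    · exact ⟨i, Set.mem_insert _ _, rfl⟩
    · obtain ⟨m, hm, hmv⟩ := hs v hv
      exact ⟨m, Set.mem_insert_of_mem _ hm, hmv⟩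

theorem hasPath_refl (G : SimpleGraph V) (f : ℕ → V) (i : ℕ) : HasPath G f {i} i i 0 :=
  ⟨.nil, by simp, by simp, by simp⟩

/-- Provides the straight stretches of a zigzag: the starting point moves down the spine from `i` to
`c` through unused vertices. -/
theorem HasPath.lane (hf : IsSpine G f n) {S : Set ℕ} {i j k : ℕ} (hS : ∀ m ∈ S, m < n)
    (hi : i < n) (h : HasPath G f S i j k) (d : ℕ) : ∀ c, c + d = i →
    (∀ m ∈ S, ¬ (c ≤ m ∧ m < i)) → HasPath G f (S ∪ Set.Ico c i) c j (k + d) := by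
  induction d with
  | zero => intro c hc _; obtain rfl : c = i := by omega
            exact h.mono Set.subset_union_left
  | succ d ih =>
    intro c hc hcS
    have h1 := ih (c + 1) (by omega) (fun m hm hmc => hcS m hm ⟨by omega, hmc.2⟩)
    refine (h1.cons hf (hf.adj c (by omega)) (by omega) ?_ ?_).mono ?_
    · rintro m (hm | hm)
      · exact hS m hm
      · exact hm.2.trans hi
    · rintro (hm | hm)
      · exact hcS c hm ⟨le_rfl, by omega⟩
      · have := hm.1; omega
    · rintro m (rfl | hm | hm)
      · exact Or.inr ⟨le_rfl, by omega⟩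
      · exact Or.inl hm
      · exact Or.inr ⟨by have := hm.1; omega, hm.2⟩

theorem hasPath_straight (hf : IsSpine G f n) {c j : ℕ} (hcj : c ≤ j) (hj : j < n) :
    HasPath G f (Set.Icc c j) c j (j - c) := by
  have := (hasPath_refl G f j).lane hf (n := n) (by simpa using hj) hj (j - c) c (by omega)
    (by rintro m rfl; omega)
  rw [zero_add] at this
  refine this.mono ?_
  rintro m (rfl | hm)
  · exact ⟨hcj, le_rfl⟩
  · exact ⟨hm.1, hm.2.le⟩

theorem HasPath.append (hf : IsSpine G f n) {S T : Set ℕ} {i m m' j k k' : ℕ}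
    (h : HasPath G f S i m k) (h' : HasPath G f T m' j k') (hadj : G.Adj (f m) (f m'))
    (hS : ∀ a ∈ S, a < n) (hT : ∀ a ∈ T, a < n) (hST : Disjoint S T) :
    HasPath G f (S ∪ T) i j (k + 1 + k') := by
  obtain ⟨p, hp, hk, hs⟩ := h
  obtain ⟨p', hp', hk', hs'⟩ := h'
  refine ⟨p.append (.cons hadj p'), ?_, ?_, ?_⟩
  · rw [SimpleGraph.Walk.isPath_def, SimpleGraph.Walk.support_append,
      SimpleGraph.Walk.support_cons, List.tail_cons]
    refine List.Nodup.append hp.support_nodup hp'.support_nodup ?_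
    intro v hv hv'
    obtain ⟨a, ha, rfl⟩ := hs v hv
    obtain ⟨b, hb, hba⟩ := hs' _ hv'
    have := hf.inj b (hT b hb) a (hS a ha) hba
    exact Set.disjoint_left.1 hST ha (this ▸ hb)
  · rw [SimpleGraph.Walk.length_append, SimpleGraph.Walk.length_cons, hk, hk']
    ring
  · intro v hv
    rw [SimpleGraph.Walk.support_append, SimpleGraph.Walk.support_cons, List.tail_cons,
      List.mem_append] at hv
    rcases hv with hv | hv
    · obtain ⟨a, ha, h⟩ := hs v hv
      exact ⟨a, Or.inl ha, h⟩
    · obtain ⟨a, ha, h⟩ := hs' v hv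
      exact ⟨a, Or.inr ha, h⟩

/-- The chord `a` goes from the part before `mid` to the part from `mid` to `hi`. -/
def IsChord (G : SimpleGraph V) (f : ℕ → V) (x : ℕ → ℕ) (mid hi a : ℕ) : Prop :=
  a < mid ∧ mid ≤ a + x a ∧ a + x a ≤ hi ∧ G.Adj (f a) (f (a + x a))

/-- The zigzag path along a chain of pairwise crossing chords, the last of them being `e`. -/
theorem exists_hasPath_of_evenVal (hf : IsSpine G f n) {x : ℕ → ℕ} {mid hi : ℕ} (hhi : hi < n)
    {S : Set ℕ} {z : ℤ} (h : EvenVal x S z) : ∀ e c : ℕ, (∀ a ∈ S, IsChord G f x mid hi a) →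
    IsChord G f x mid hi e → (∀ y ∈ S, Prec x y e) → (∀ y ∈ S, c ≤ y) → c ≤ e →
    ∃ k : ℕ, HasPath G f {m | m ≤ hi ∧ (c ≤ m ∧ m < mid ∨
      mid ≤ m ∧ ∃ y ∈ insert e S, y + x y ≤ m)} c hi k ∧ (k : ℤ) = hi - c + 1 + z - x e := by
  induction h with
  | nil S =>
    intro e c _ he _ _ hce
    obtain ⟨h1, h2, h3, h4⟩ := he
    have p1 := (hasPath_straight hf h3 hhi).cons hf h4 (by omega) (fun m hm => hm.2.trans_lt hhi)
      (fun hm => by have := hm.1; omega)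
    have p2 := p1.lane hf (n := n) (by
      rintro m (rfl | hm)
      · omega
      · exact hm.2.trans_lt hhi) (by omega) (e - c) c (by omega) (by
      rintro m (rfl | hm)
      · omega
      · have := hm.1; omega)
    refine ⟨_, p2.mono ?_, by push_cast; omega⟩
    rintro m ((rfl | hm) | hm)
    · exact ⟨by omega, Or.inl ⟨hce, h1⟩⟩
    · exact ⟨hm.2, Or.inr ⟨h2.trans hm.1, e, Set.mem_insert _ _, hm.1⟩⟩
    · have := hm.1; have := hm.2
      exact ⟨by omega, Or.inl ⟨by omega, by omega⟩⟩
  | cons S S' p p' z hp hp' hpp hS _ hlt ih =>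
    intro e c hch he hSe hcS hce
    obtain ⟨k, hk, hkz⟩ := ih e p' (fun a ha => hch a (hS ha)) he (fun y hy => hSe y (hS hy))
      (fun y hy => (hlt y hy).1.le) (hSe p' hp').1.le
    obtain ⟨h1, h2, h3, h4⟩ := hch p hp
    obtain ⟨h1', h2', h3', h4'⟩ := hch p' hp'
    have hcp := hcS p hp
    have hpp1 := hpp.1
    have hpp2 := hpp.2
    -- The rest of the path meets the upper part only at or beyond the ends of later chords, so the
    -- stretch from `p + x p` to `p' + x p'` is free.
    have hgt : ∀ y ∈ insert e S', p' + x p' < y + x y := by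
      rintro y (rfl | hy)
      · exact (hSe p' hp').2
      · exact (hlt y hy).2
    -- In order of travel the new piece is: up the spine from `c` to `p`, across the chord of `p`,
    -- up to `p' + x p'`, and back along the chord of `p'`. Its length is `(p' - c) + (x p' - x p +
    -- 2)`.
    have p1 := hk.cons hf h4'.symm (by omega) (fun m hm => hm.1.trans_lt hhi) (by
      rintro ⟨-, hm | ⟨-, y, hy, hm⟩⟩
      · omega
      · have := hgt y hy; omega)
    have p2 := p1.lane hf (n := n) (by
      rintro m (rfl | hm)
      · omega
      · exact hm.1.trans_lt hhi) (by omega) (p' + x p' - (p + x p)) (p + x p) (by omega) (by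
      rintro m (rfl | ⟨-, hm | ⟨-, y, hy, hm⟩⟩)
      · omega
      · omega
      · have := hgt y hy; omega)
    have p3 := p2.cons hf h4 (by omega) (by
      rintro m ((rfl | hm) | hm)
      · omega
      · exact hm.1.trans_lt hhi
      · have := hm.2; omega) (by
      rintro ((hm | ⟨-, hm | hm⟩) | hm)
      · omega
      · omega
      · omega
      · have := hm.1; omega)
    have p4 := p3.lane hf (n := n) (by
      rintro m (rfl | (rfl | hm) | hm)
      · omega
      · omega
      · exact hm.1.trans_lt hhi
      · have := hm.2; omega) (by omega) (p - c) c (by omega) (by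
      rintro m (rfl | (rfl | ⟨-, hm | hm⟩) | hm)
      · omega
      · omega
      · omega
      · omega
      · have := hm.1; omega)
    refine ⟨_, p4.mono ?_, by push_cast; omega⟩
    rintro m ((rfl | (rfl | ⟨hm, hm' | ⟨hm', y, hy, hym⟩⟩) | hm) | hm)
    · exact ⟨by omega, Or.inl ⟨by omega, by omega⟩⟩
    · exact ⟨by omega, Or.inr ⟨by omega, p', Set.mem_insert_of_mem _ hp', le_rfl⟩⟩
    · exact ⟨hm, Or.inl ⟨by omega, by omega⟩⟩
    · exact ⟨hm, Or.inr ⟨hm', y, Set.insert_subset_insert hS hy, hym⟩⟩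
    · have := hm.1; have := hm.2
      exact ⟨by omega, Or.inr ⟨by omega, p, Set.mem_insert_of_mem _ hp, by omega⟩⟩
    · have := hm.1; have := hm.2
      exact ⟨by omega, Or.inl ⟨by omega, by omega⟩⟩

theorem exists_hasPath_of_oddVal (hf : IsSpine G f n) {x : ℕ → ℕ} {lo mid hi : ℕ} (hhi : hi < n)
    {S : Set ℕ} {z : ℤ} (h : OddVal x S z) (hS : ∀ a ∈ S, lo ≤ a ∧ IsChord G f x mid hi a) :
    ∃ k : ℕ, HasPath G f (Set.Icc lo hi) lo hi k ∧ (k : ℤ) = hi - lo + 1 + z := by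
  obtain ⟨e, he, S', hS', z', hz', hlt, rfl⟩ := h
  obtain ⟨k, hk, hkz⟩ := exists_hasPath_of_evenVal hf hhi hz' e lo (fun a ha => (hS a (hS' ha)).2)
    (hS e he).2 hlt (fun a ha => (hS a (hS' ha)).1) (hS e he).1
  have := (hS e he).1
  have := (hS e he).2.1
  refine ⟨k, hk.mono ?_, by omega⟩
  rintro m ⟨hm, hm' | hm'⟩
  · exact ⟨hm'.1, hm⟩
  · exact ⟨by omega, hm⟩

end

/-! ### Gluing segments of the spine. -/

section

variable {V : Type*} {G : SimpleGraph V} {f : ℕ → V} {n : ℕ}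

theorem exists_lengths_of_chords (hf : IsSpine G f n) {x : ℕ → ℕ} {lo mid hi r L k : ℕ}
    (hlo : lo ≤ hi) (hhi : hi < n) (hr : 0 < r) (hL : 2 * windowLen r k ≤ 2 ^ L) {P : Finset ℕ}
    (hPc : #P ≤ windowLen r k)
    (hP : ∀ a ∈ P, lo ≤ a ∧ IsChord G f x mid hi a) (hx : ∀ a ∈ P, 2 ≤ x a) :
    ∃ Λ : Finset ℕ, Λ.Nonempty ∧ (∀ m ∈ Λ, HasPath G f (Set.Icc lo hi) lo hi m) ∧
      #P ≤ 2 * lossFactor r L k * (#Λ - 1) := by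
  classical
  rcases P.eq_empty_or_nonempty with rfl | ⟨e, he⟩
  · exact ⟨{hi - lo}, by simp, by simpa using hasPath_straight hf hlo hhi, by simp⟩
  obtain ⟨Λ, hΛ, hΛc⟩ := exists_oddVal (x := x) hr hL hPc
  have hpath : ∀ z, OddVal x P z → ∃ k : ℕ, HasPath G f (Set.Icc lo hi) lo hi k ∧
      (k : ℤ) = hi - lo + 1 + z := fun z hz =>
    exists_hasPath_of_oddVal hf hhi hz fun a ha => hP a (Finset.mem_coe.1 ha)
  set φ : ℤ → ℕ := fun z => ((hi : ℤ) - lo + 1 + z).toNat with hφ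
  have hφp : ∀ z, OddVal x P z → HasPath G f (Set.Icc lo hi) lo hi (φ z) ∧
      (φ z : ℤ) = hi - lo + 1 + z := by
    intro z hz
    obtain ⟨k, hk, hkz⟩ := hpath z hz
    have : φ z = k := by simp only [hφ]; omega
    rw [this]
    exact ⟨hk, hkz⟩
  have hev : OddVal x P (-(x e : ℤ)) := oddVal_single (Finset.mem_coe.2 he)
  -- Adding the straight path and a one-chord path forces at least two lengths, so that `#Λ' ≤ 2 *
  -- (#Λ' - 1)`; it is `#Λ' - 1` that adds up over segments.
  set Λ' := insert (hi - lo) (insert (φ (-(x e : ℤ))) (Λ.image φ)) with hΛ'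
  have h1 : #Λ ≤ #Λ' := by
    rw [← Finset.card_image_of_injOn (f := φ) (s := Λ)]
    · exact Finset.card_le_card ((Finset.subset_insert _ _).trans (Finset.subset_insert _ _))
    · intro z hz z' hz' h
      have h1 := (hφp z (hΛ z hz)).2
      have h2 := (hφp z' (hΛ z' hz')).2
      have h3 : φ z = φ z' := h
      rw [h3] at h1
      omega
  have h2 : 2 ≤ #Λ' := by
    have hne : hi - lo ≠ φ (-(x e : ℤ)) := by
      have h1 := (hφp _ hev).2
      have h2 := hx e he
      omega
    have hsub : {hi - lo, φ (-(x e : ℤ))} ⊆ Λ' := by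
      intro m hm
      simp only [Finset.mem_insert, Finset.mem_singleton] at hm
      rcases hm with rfl | rfl
      · exact Finset.mem_insert_self _ _
      · exact Finset.mem_insert_of_mem (Finset.mem_insert_self _ _)
    calc 2 = #{hi - lo, φ (-(x e : ℤ))} := (Finset.card_pair hne).symm
      _ ≤ _ := Finset.card_le_card hsub
  refine ⟨Λ', ⟨_, Finset.mem_insert_self _ _⟩, ?_, ?_⟩
  · intro m hm
    rcases Finset.mem_insert.1 hm with rfl | hm
    · exact hasPath_straight hf hlo hhi
    rcases Finset.mem_insert.1 hm with rfl | hm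
    · exact (hφp _ hev).1
    · obtain ⟨z, hz, rfl⟩ := Finset.mem_image.1 hm
      exact (hφp z (hΛ z hz)).1
  · calc #P ≤ lossFactor r L k * #Λ := hΛc
      _ ≤ lossFactor r L k * (2 * (#Λ' - 1)) := Nat.mul_le_mul_left _ (by omega)
      _ = _ := by ring

open scoped Pointwise in
theorem exists_lengths_append (hf : IsSpine G f n) {lo m hi : ℕ} (hm : m + 1 ≤ hi) (hhi : hi < n)
    {Λ₁ Λ₂ : Finset ℕ} (h₁ : ∀ k ∈ Λ₁, HasPath G f (Set.Icc lo m) lo m k)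
    (h₂ : ∀ k ∈ Λ₂, HasPath G f (Set.Icc (m + 1) hi) (m + 1) hi k) (hne₁ : Λ₁.Nonempty)
    (hne₂ : Λ₂.Nonempty) (hlo : lo ≤ m) :
    ∃ Λ : Finset ℕ, Λ.Nonempty ∧ (∀ k ∈ Λ, HasPath G f (Set.Icc lo hi) lo hi k) ∧
      (#Λ₁ - 1) + (#Λ₂ - 1) ≤ #Λ - 1 := by
  classical
  refine ⟨(Λ₁ ×ˢ Λ₂).image fun p => p.1 + 1 + p.2, (hne₁.product hne₂).image _, ?_, ?_⟩
  · intro k hk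
    obtain ⟨⟨a, b⟩, hab, rfl⟩ := Finset.mem_image.1 hk
    rw [Finset.mem_product] at hab
    refine ((h₁ a hab.1).append hf (h₂ b hab.2) (hf.adj m (by omega)) ?_ ?_ ?_).mono ?_
    · rintro c ⟨-, hc⟩; omega
    · rintro c ⟨-, hc⟩; omega
    · rw [Set.disjoint_left]
      rintro c ⟨-, hc⟩ ⟨hc', -⟩
      omega
    · rintro c (⟨hc, hc'⟩ | ⟨hc, hc'⟩)
      · exact ⟨hc, by omega⟩
      · exact ⟨by omega, hc'⟩
  · have h := cauchy_davenport_add_of_linearOrder_isCancelAdd hne₁ hne₂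
    have himg : ((Λ₁ ×ˢ Λ₂).image fun p => p.1 + 1 + p.2) =
        (Λ₁ + Λ₂).image fun a => a + 1 := by
      ext c
      simp only [Finset.mem_image, Finset.mem_product, Finset.mem_add, Prod.exists]
      constructor
      · rintro ⟨a, b, ⟨ha, hb⟩, rfl⟩
        exact ⟨a + b, ⟨a, ha, b, hb, rfl⟩, by ring⟩
      · rintro ⟨_, ⟨a, ha, b, hb, rfl⟩, rfl⟩
        exact ⟨a, b, ⟨ha, hb⟩, by ring⟩
    rw [himg, Finset.card_image_of_injective _ (add_left_injective 1)]
    have := Finset.card_pos.2 hne₁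
    have := Finset.card_pos.2 hne₂
    omega

/-- A chord starting in `[lo, lo + ℓ)` with length in `[2 * ℓ, 4 * ℓ)` ends in `[lo + 2 * ℓ, lo + 5
* ℓ)`. So it passes over `lo + ℓ` and stays in a segment of length `5 * ℓ`, after which the next
admissible block of starting points begins. -/
theorem exists_lengths_from (hf : IsSpine G f n) {x : ℕ → ℕ} {r L k ℓ c : ℕ} (hr : 0 < r)
    (hL : 2 * windowLen r k ≤ 2 ^ L) (hℓ : 0 < ℓ) {P : Finset ℕ} (hPc : #P ≤ windowLen r k)
    (hPx : ∀ a ∈ P, 2 * ℓ ≤ x a ∧ x a < 4 * ℓ)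
    (hP : ∀ a ∈ P, a + x a < n ∧ G.Adj (f a) (f (a + x a))) (hPm : ∀ a ∈ P, a / ℓ % 5 = c)
    (t : ℕ) : ∀ j, n ≤ (5 * j + c) * ℓ + t → (5 * j + c) * ℓ < n →
    ∃ Λ : Finset ℕ, Λ.Nonempty ∧
      (∀ m ∈ Λ, HasPath G f (Set.Icc ((5 * j + c) * ℓ) (n - 1)) ((5 * j + c) * ℓ) (n - 1) m) ∧
      #{a ∈ P | (5 * j + c) * ℓ ≤ a} ≤ 2 * lossFactor r L k * (#Λ - 1) := by
  induction t using Nat.strong_induction_on with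
  | _ t ih =>
  intro j hnt hlt
  set lo := (5 * j + c) * ℓ with hlo
  have hnext : (5 * (j + 1) + c) * ℓ = lo + 5 * ℓ := by rw [hlo]; ring
  have hmid : (5 * j + c + 1) * ℓ = lo + ℓ := by rw [hlo]; ring
  have hone : ∀ hi, lo ≤ hi → hi < n → (hi + 1 = n ∨ hi + 1 = lo + 5 * ℓ) →
      ∃ Λ : Finset ℕ, Λ.Nonempty ∧ (∀ m ∈ Λ, HasPath G f (Set.Icc lo hi) lo hi m) ∧
        #{a ∈ P | a / ℓ = 5 * j + c} ≤ 2 * lossFactor r L k * (#Λ - 1) := by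
    intro hi hlohi hhi hcase
    refine exists_lengths_of_chords hf (x := x) (mid := lo + ℓ) hlohi hhi hr hL
      ((Finset.card_filter_le _ _).trans hPc) ?_ ?_
    · intro a ha
      obtain ⟨ha, haj⟩ := Finset.mem_filter.1 ha
      have h1 := hPx a ha
      have h2 := hP a ha
      have h3 : lo ≤ a := by rw [hlo, ← haj]; exact Nat.div_mul_le_self _ _
      have h4 : a < lo + ℓ := by rw [← hmid, ← haj, mul_comm]; exact Nat.lt_mul_div_succ a hℓ
      refine ⟨h3, h4, by omega, by omega, h2.2⟩
    · intro a ha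
      have := hPx a (Finset.filter_subset _ _ ha)
      omega
  have hge : ∀ a ∈ P, lo ≤ a → a / ℓ = 5 * j + c ∨ lo + 5 * ℓ ≤ a := by
    intro a ha hla
    have h1 : 5 * j + c ≤ a / ℓ := (Nat.le_div_iff_mul_le hℓ).2 hla
    have h2 := hPm a ha
    by_cases h : a / ℓ = 5 * j + c
    · exact Or.inl h
    · right
      rw [← hnext]
      refine (Nat.le_div_iff_mul_le hℓ).1 ?_
      omega
  by_cases hn : n ≤ lo + 5 * ℓ
  · obtain ⟨Λ, hne, hΛ, hc⟩ := hone (n - 1) (by omega) (by omega) (by omega)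
    refine ⟨Λ, hne, hΛ, le_trans (Finset.card_le_card ?_) hc⟩
    intro a ha
    obtain ⟨ha, hla⟩ := Finset.mem_filter.1 ha
    have := (hP a ha).1
    exact Finset.mem_filter.2 ⟨ha, (hge a ha hla).resolve_right (by omega)⟩
  · obtain ⟨Λ₁, hne₁, hΛ₁, hc₁⟩ := hone (lo + 5 * ℓ - 1) (by omega) (by omega) (by omega)
    obtain ⟨Λ₂, hne₂, hΛ₂, hc₂⟩ := ih (n - (lo + 5 * ℓ)) (by omega) (j + 1) (by omega) (by omega)
    rw [hnext] at hΛ₂ hc₂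
    have e : lo + 5 * ℓ = lo + 5 * ℓ - 1 + 1 := by omega
    rw [e] at hΛ₂
    obtain ⟨Λ, hne, hΛ, hc⟩ := exists_lengths_append hf (by omega) (by omega) hΛ₁ hΛ₂ hne₁ hne₂
      (by omega)
    refine ⟨Λ, hne, hΛ, ?_⟩
    have hsub : {a ∈ P | lo ≤ a} ⊆ {a ∈ P | a / ℓ = 5 * j + c} ∪ {a ∈ P | lo + 5 * ℓ ≤ a} := by
      intro a ha
      obtain ⟨ha, hla⟩ := Finset.mem_filter.1 ha
      simpa [ha] using hge a ha hla
    calc #{a ∈ P | lo ≤ a} ≤ _ := Finset.card_le_card hsub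
      _ ≤ _ := Finset.card_union_le _ _
      _ ≤ 2 * lossFactor r L k * (#Λ₁ - 1) + 2 * lossFactor r L k * (#Λ₂ - 1) := by gcongr
      _ = 2 * lossFactor r L k * ((#Λ₁ - 1) + (#Λ₂ - 1)) := by ring
      _ ≤ _ := Nat.mul_le_mul_left _ hc

theorem exists_lengths_of_class (hf : IsSpine G f n) (hn : 0 < n) {x : ℕ → ℕ} {r L k ℓ c : ℕ}
    (hr : 0 < r) (hL : 2 * windowLen r k ≤ 2 ^ L) (hℓ : 0 < ℓ) {P : Finset ℕ}
    (hPc : #P ≤ windowLen r k) (hPx : ∀ a ∈ P, 2 * ℓ ≤ x a ∧ x a < 4 * ℓ)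
    (hP : ∀ a ∈ P, a + x a < n ∧ G.Adj (f a) (f (a + x a))) (hPm : ∀ a ∈ P, a / ℓ % 5 = c) :
    ∃ Λ : Finset ℕ, (∀ m ∈ Λ, HasPath G f (Set.Icc 0 (n - 1)) 0 (n - 1) m) ∧
      #P ≤ 2 * lossFactor r L k * #Λ := by
  have hge : ∀ a ∈ P, c * ℓ ≤ a := by
    intro a ha
    refine (Nat.le_div_iff_mul_le hℓ).1 ?_
    exact hPm a ha ▸ Nat.mod_le _ _
  by_cases hcn : n ≤ c * ℓ
  · refine ⟨∅, by simp, ?_⟩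
    have : P = ∅ := by
      rw [Finset.eq_empty_iff_forall_notMem]
      intro a ha
      have := hge a ha
      have := (hP a ha).1
      omega
    simp [this]
  obtain ⟨Λ, hne, hΛ, hc⟩ := exists_lengths_from hf (x := x) hr hL hℓ hPc hPx hP hPm n 0
    (by omega) (by simpa using hcn)
  simp only [mul_zero, zero_add] at hΛ hc
  rw [Finset.filter_true_of_mem hge] at hc
  rcases Nat.eq_zero_or_pos (c * ℓ) with h0 | hpos
  · rw [h0] at hΛ
    exact ⟨Λ, hΛ, hc.trans (Nat.mul_le_mul_left _ (Nat.sub_le _ _))⟩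
  · have e : c * ℓ = c * ℓ - 1 + 1 := by omega
    rw [e] at hΛ
    -- The initial stretch before the first admissible block is traversed straight.
    obtain ⟨Λ', -, hΛ', hc'⟩ := exists_lengths_append hf (lo := 0) (m := c * ℓ - 1)
      (Λ₁ := {c * ℓ - 1}) (by omega) (by omega)
      (by simpa using hasPath_straight hf (Nat.zero_le (c * ℓ - 1)) (by omega)) hΛ
      (by simp) hne (by omega)
    refine ⟨Λ', hΛ', hc.trans (Nat.mul_le_mul_left _ ?_)⟩
    simp only [Finset.card_singleton] at hc'
    omega

theorem exists_lengths (hf : IsSpine G f n) (hn : 0 < n) {x : ℕ → ℕ} {r L k : ℕ}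
    (hr : 0 < r) (hL : 2 * windowLen r k ≤ 2 ^ L) (hnk : n ≤ windowLen r k) {P : Finset ℕ}
    (hPx : ∀ a ∈ P, 2 ≤ x a) (hP : ∀ a ∈ P, a + x a < n ∧ G.Adj (f a) (f (a + x a))) :
    ∃ Λ : Finset ℕ, (∀ m ∈ Λ, HasPath G f (Set.Icc 0 (n - 1)) 0 (n - 1) m) ∧
      #P ≤ 10 * L * lossFactor r L k * #Λ := by
  have hPn : #P ≤ n := by
    have : P ⊆ Finset.range n := fun a ha => Finset.mem_range.2 (by have := (hP a ha).1; omega)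
    simpa using Finset.card_le_card this
  have hLpos : 0 < L := by
    rcases Nat.eq_zero_or_pos L with rfl | hLp
    · simp at hL; omega
    · exact hLp
  -- With `ℓ = 2 ^ (i - 1)`, a length of dyadic order `i` lies in `[2 * ℓ, 4 * ℓ)`; the second
  -- coordinate is the residue modulo `5` of the block of length `ℓ` containing the start.
  obtain ⟨⟨i, c⟩, -, hy⟩ := exists_large_fiber (s := P)
    (t := Finset.range L ×ˢ Finset.range 5)
    (f := fun a => (Nat.log 2 (x a), a / 2 ^ (Nat.log 2 (x a) - 1) % 5)) (by
      intro a ha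
      have h1 := hPx a ha
      have h2 := (hP a ha).1
      simp only [Finset.mem_product, Finset.mem_range]
      exact ⟨Nat.log_lt_of_lt_pow (by omega) (by omega), Nat.mod_lt _ (by norm_num)⟩)
    (by simp [Finset.nonempty_iff_ne_empty, ← Finset.card_eq_zero]; omega)
  rw [Finset.card_product, Finset.card_range, Finset.card_range] at hy
  set Q := {a ∈ P | (Nat.log 2 (x a), a / 2 ^ (Nat.log 2 (x a) - 1) % 5) = (i, c)} with hQ
  have hQm : ∀ a ∈ Q, a ∈ P ∧ Nat.log 2 (x a) = i ∧ a / 2 ^ (i - 1) % 5 = c := by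
    intro a ha
    obtain ⟨ha, h⟩ := Finset.mem_filter.1 ha
    simp only [Prod.mk.injEq] at h
    exact ⟨ha, h.1, h.1 ▸ h.2⟩
  obtain ⟨Λ, hΛ, hc⟩ := exists_lengths_of_class hf hn (x := x) (ℓ := 2 ^ (i - 1)) (c := c) hr hL
    (by positivity) (P := Q) ((Finset.card_filter_le _ _).trans (hPn.trans hnk)) (by
      intro a ha
      obtain ⟨haP, hai, -⟩ := hQm a ha
      have h2 := hPx a haP
      have h3 : 1 ≤ i := by rw [← hai]; exact Nat.log_pos (by norm_num) h2
      have h4 : 2 * 2 ^ (i - 1) = 2 ^ i := by rw [← pow_succ']; congr 1; omega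
      have h5 : 2 ^ i ≤ x a := by rw [← hai]; exact Nat.pow_log_le_self 2 (by omega)
      have h6 : x a < 2 ^ (i + 1) := by
        rw [← hai]; exact Nat.lt_pow_succ_log_self (by norm_num) _
      rw [pow_succ] at h6
      constructor <;> omega)
    (fun a ha => hP a (hQm a ha).1) (fun a ha => (hQm a ha).2.2)
  refine ⟨Λ, hΛ, ?_⟩
  calc #P ≤ L * 5 * #Q := hy
    _ ≤ L * 5 * (2 * lossFactor r L k * #Λ) := Nat.mul_le_mul_left _ hc
    _ = _ := by ring

end

/-! ### From paths to cycles in the Hamiltonian graph. -/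

/-- The vertices `f 0, …, f (n - 1)` form a cycle of `G`. -/
structure IsCyclicSpine {V : Type*} (G : SimpleGraph V) (f : ℕ → V) (n : ℕ) : Prop
    extends IsSpine G f n where
  four_le : 4 ≤ n
  close : G.Adj (f (n - 1)) (f 0)

section

variable {V : Type*} {G : SimpleGraph V} {f : ℕ → V} {n : ℕ}

/-- The closing edge is deleted beforehand so that the path cannot use it. -/
theorem mem_cycleSpectrum_of_hasPath {S : Set ℕ} {k : ℕ} (hclose : G.Adj (f (n - 1)) (f 0))
    (h : HasPath (G.deleteEdges {s(f (n - 1), f 0)}) f S 0 (n - 1) k) :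
    k + 1 ∈ G.cycleSpectrum := by
  obtain ⟨p, hp, hk, -⟩ := h
  refine ⟨f (n - 1), .cons hclose (p.mapLe (G.deleteEdges_le _)), ?_, by simp [hk]⟩
  rw [SimpleGraph.Walk.cons_isCycle_iff]
  refine ⟨hp.mapLe _, fun hmem => ?_⟩
  rw [SimpleGraph.Walk.edges_mapLe_eq_edges] at hmem
  have := p.edges_subset_edgeSet hmem
  simp at this

theorem IsCyclicSpine.deleteEdges_adj (hf : IsCyclicSpine G f n) {a b : ℕ} (hab : a + 1 ≤ b)
    (hb : b < n) (h : G.Adj (f a) (f b)) (hne : 1 ≤ a ∨ b + 1 < n) :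
    (G.deleteEdges {s(f (n - 1), f 0)}).Adj (f a) (f b) := by
  have h4 := hf.four_le
  rw [SimpleGraph.deleteEdges_adj]
  refine ⟨h, fun hmem => ?_⟩
  rw [Set.mem_singleton_iff, Sym2.eq_iff] at hmem
  rcases hmem with ⟨h1, h2⟩ | ⟨h1, h2⟩
  · have := hf.inj b hb 0 (by omega) h2
    omega
  · have := hf.inj a (by omega) 0 (by omega) h1
    have := hf.inj b hb (n - 1) (by omega) h2
    omega

theorem IsCyclicSpine.reverse (hf : IsCyclicSpine G f n) :
    IsCyclicSpine G (fun i => f (n - 1 - i)) n := by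
  have h4 := hf.four_le
  refine ⟨⟨?_, ?_⟩, h4, ?_⟩
  · intro i hi j hj h
    have := hf.inj _ (by omega) _ (by omega) h
    omega
  · intro i hi
    have := hf.adj (n - 1 - (i + 1)) (by omega)
    rw [show n - 1 - (i + 1) + 1 = n - 1 - i by omega] at this
    exact this.symm
  · simpa using hf.close.symm

open scoped Classical in
/-- The interior vertices of the cycle with a chord going up. -/
noncomputable def upVertices (G : SimpleGraph V) (f : ℕ → V) (n : ℕ) : Finset ℕ :=
  {a ∈ Finset.Ico 1 (n - 1) | ∃ j, a + 2 ≤ j ∧ j < n ∧ G.Adj (f a) (f j)}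

theorem card_upVertices_le [Finite V] (hf : IsCyclicSpine G f n) {r L k : ℕ} (hr : 0 < r)
    (hL : 2 * windowLen r k ≤ 2 ^ L) (hnk : n ≤ windowLen r k) :
    #(upVertices G f n) ≤ 10 * L * lossFactor r L k * G.cycleSpectrum.ncard := by
  classical
  have h4 := hf.four_le
  have hex : ∀ a ∈ upVertices G f n, ∃ x, 2 ≤ x ∧ a + x < n ∧
      (G.deleteEdges {s(f (n - 1), f 0)}).Adj (f a) (f (a + x)) := by
    intro a ha
    rw [upVertices, Finset.mem_filter, Finset.mem_Ico] at ha
    obtain ⟨⟨h1, h2⟩, j, hj, hjn, hadj⟩ := ha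
    refine ⟨j - a, by omega, by omega, ?_⟩
    rw [show a + (j - a) = j by omega]
    exact hf.deleteEdges_adj (by omega) hjn hadj (Or.inl h1)
  choose! x hx2 hxn hxadj using hex
  have hsp : IsSpine (G.deleteEdges {s(f (n - 1), f 0)}) f n :=
    ⟨hf.inj, fun i hi => hf.deleteEdges_adj le_rfl hi (hf.adj i hi) (by omega)⟩
  obtain ⟨Λ, hΛ, hc⟩ := exists_lengths hsp (by omega) hr hL hnk hx2
    (fun a ha => ⟨hxn a ha, hxadj a ha⟩)
  refine hc.trans (Nat.mul_le_mul_left _ ?_)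
  have := Fintype.ofFinite V
  rw [← Finset.card_image_of_injective Λ (add_left_injective 1), ← Set.ncard_coe_finset]
  refine Set.ncard_le_ncard ?_ G.cycleSpectrum_finite
  intro m hm
  obtain ⟨k, hk, rfl⟩ := Finset.mem_image.1 (Finset.mem_coe.1 hm)
  exact mem_cycleSpectrum_of_hasPath hf.close (hΛ k hk)

theorem mem_upVertices_or_reverse [Fintype V] [DecidableRel G.Adj]
    (hsurj : ∀ v, ∃ i < n, f i = v) (hdeg : 3 ≤ G.minDegree) {a : ℕ} (h1 : 1 ≤ a)
    (h2 : a < n - 1) :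
    a ∈ upVertices G f n ∨ n - 1 - a ∈ upVertices G (fun i => f (n - 1 - i)) n := by
  classical
  have hd : 3 ≤ #(G.neighborFinset (f a)) := hdeg.trans (G.minDegree_le_degree (f a))
  obtain ⟨w, hw, hwn⟩ := Finset.exists_mem_notMem_of_card_lt_card
    (s := {f (a - 1), f (a + 1)}) (t := G.neighborFinset (f a))
    ((Finset.card_le_two).trans_lt (by omega))
  rw [SimpleGraph.mem_neighborFinset] at hw
  obtain ⟨j, hj, rfl⟩ := hsurj w
  simp only [Finset.mem_insert, Finset.mem_singleton, not_or] at hwn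
  have hj1 : j ≠ a - 1 := fun h => hwn.1 (by rw [h])
  have hj2 : j ≠ a + 1 := fun h => hwn.2 (by rw [h])
  have hj3 : j ≠ a := fun h => hw.ne (by rw [h])
  simp only [upVertices, Finset.mem_filter, Finset.mem_Ico]
  rcases lt_or_gt_of_ne hj3 with hlt | hlt
  · right
    refine ⟨⟨by omega, by omega⟩, n - 1 - j, by omega, by omega, ?_⟩
    rwa [show n - 1 - (n - 1 - a) = a by omega, show n - 1 - (n - 1 - j) = j by omega]
  · left
    exact ⟨⟨h1, h2⟩, j, by omega, hj, hw⟩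

theorem card_le_mul_ncard_cycleSpectrum [Fintype V] [DecidableRel G.Adj]
    (hf : IsCyclicSpine G f n) (hsurj : ∀ v, ∃ i < n, f i = v) (hdeg : 3 ≤ G.minDegree)
    {r L k : ℕ} (hr : 0 < r) (hL : 2 * windowLen r k ≤ 2 ^ L) (hnk : n ≤ windowLen r k) :
    n ≤ 40 * L * lossFactor r L k * G.cycleSpectrum.ncard := by
  classical
  have h4 := hf.four_le
  have hu := card_upVertices_le hf hr hL hnk
  have hd := card_upVertices_le hf.reverse hr hL hnk
  have hsub : Finset.Ico 1 (n - 1) ⊆ upVertices G f n ∪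
      (upVertices G (fun i => f (n - 1 - i)) n).image fun b => n - 1 - b := by
    intro a ha
    rw [Finset.mem_Ico] at ha
    rcases mem_upVertices_or_reverse hsurj hdeg ha.1 ha.2 with h | h
    · exact Finset.mem_union_left _ h
    · exact Finset.mem_union_right _ (Finset.mem_image.2 ⟨_, h, by omega⟩)
  have h1 := (Finset.card_le_card hsub).trans (Finset.card_union_le _ _)
  rw [Nat.card_Ico] at h1
  have h2 := (Finset.card_image_le (s := upVertices G (fun i => f (n - 1 - i)) n)
    (f := fun b => n - 1 - b))
  have h3 : n ≤ 2 * (n - 1 - 1) := by omega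
  linarith

end

theorem SimpleGraph.IsHamiltonian.exists_isCyclicSpine {V : Type*} [Fintype V] [DecidableEq V]
    {G : SimpleGraph V} [DecidableRel G.Adj] (hG : G.IsHamiltonian) (hdeg : 3 ≤ G.minDegree) :
    ∃ f : ℕ → V, IsCyclicSpine G f (Fintype.card V) ∧ ∀ v, ∃ i < Fintype.card V, f i = v := by
  have hne : Nonempty V := by
    by_contra h
    rw [not_nonempty_iff] at h
    simp at hdeg
  obtain ⟨v⟩ := hne
  have hcard : 4 ≤ Fintype.card V := by
    have := G.minDegree_le_degree v
    have := G.degree_lt_card_verts v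
    omega
  obtain ⟨a, p, hp⟩ := hG (by omega)
  have hlen := hp.length_eq
  have hinj : ∀ i < Fintype.card V, ∀ j < Fintype.card V, p.getVert i = p.getVert j → i = j := by
    intro i hi j hj h
    exact hp.isCycle.getVert_injOn' (by simp; omega) (by simp; omega) h
  refine ⟨p.getVert, ⟨⟨hinj, ?_⟩, hcard, ?_⟩, ?_⟩
  · intro i hi
    exact p.adj_getVert_succ (by omega)
  · have := p.adj_getVert_succ (i := Fintype.card V - 1) (by omega)
    rw [show Fintype.card V - 1 + 1 = p.length by omega, p.getVert_length] at this
    simpa using this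
  · have hsur : Function.Surjective fun i : Fin (Fintype.card V) => p.getVert i := by
      refine ((Fintype.bijective_iff_injective_and_card _).2 ⟨?_, by simp⟩).surjective
      intro i j h
      exact Fin.ext (hinj i i.2 j j.2 h)
    intro v
    obtain ⟨i, hi⟩ := hsur v
    exact ⟨i, i.2, hi⟩

/-! ### Choice of parameters and asymptotics. -/

theorem lossFactor_two_pow_le (m : ℕ) :
    40 * (m * m + 2) * lossFactor (2 ^ m) (m * m + 2) m ≤ 2 ^ (25 + 15 * m) := by
  have h1 : m + 1 ≤ 2 ^ m := Nat.lt_two_pow_self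
  have h2 : m * m + 2 ≤ 3 * 4 ^ m := by
    have h3 : m * m ≤ 2 ^ m * 2 ^ m := Nat.mul_le_mul (by omega) (by omega)
    rw [← mul_pow] at h3
    have : 1 ≤ 4 ^ m := Nat.one_le_pow _ _ (by norm_num)
    norm_num at h3
    omega
  have e : ∀ c : ℕ, (2 ^ c) ^ m = (2 ^ m) ^ c := fun c => by rw [← pow_mul, ← pow_mul, mul_comm]
  have e4 : 4 ^ m = (2 ^ m) ^ 2 := e 2
  have e8 : 8 ^ m = (2 ^ m) ^ 3 := e 3
  calc 40 * (m * m + 2) * lossFactor (2 ^ m) (m * m + 2) m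
      = 40 * (m * m + 2) * ((m + 1) * (3 * (8 ^ m * 4 ^ (m + 2) *
          (128 * (2 ^ m) ^ 3 * (m * m + 2))) * (8 * 4 ^ m))) := rfl
    _ ≤ 40 * (3 * 4 ^ m) * (2 ^ m * (3 * (8 ^ m * 4 ^ (m + 2) *
          (128 * (2 ^ m) ^ 3 * (3 * 4 ^ m))) * (8 * 4 ^ m))) := by gcongr
    _ = 17694720 * (2 ^ m) ^ 15 := by
        rw [pow_add 4 m 2, e4, e8]; ring
    _ ≤ 2 ^ 25 * (2 ^ m) ^ 15 := Nat.mul_le_mul_right _ (by norm_num)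
    _ = _ := by rw [pow_add, ← pow_mul, mul_comm m]

open Real in
theorem card_le_rpow_mul_ncard_cycleSpectrum {V : Type*} [Fintype V] [DecidableEq V]
    {G : SimpleGraph V} [DecidableRel G.Adj] (hG : G.IsHamiltonian) (hdeg : 3 ≤ G.minDegree) :
    4 ≤ Fintype.card V ∧ (Fintype.card V : ℝ) ≤
      (2 : ℝ) ^ (40 + 15 * √(logb 2 (Fintype.card V))) * G.cycleSpectrum.ncard := by
  obtain ⟨f, hf, hsurj⟩ := hG.exists_isCyclicSpine hdeg
  refine ⟨hf.four_le, ?_⟩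
  set n := Fintype.card V
  have hn : (0 : ℝ) < n := by exact_mod_cast (by have := hf.four_le; omega : 0 < n)
  -- The loss is polynomial in `r` and exponential in `k`, with `r ^ k` about `n`; `r = 2 ^ m`, `k =
  -- m` balances the two. Rounding up turns `25` into `40` in the exponent.
  set m := ⌈√(logb 2 (n : ℝ))⌉₊ with hm
  have hm1 : √(logb 2 (n : ℝ)) ≤ m := Nat.le_ceil _
  have hm2 : (m : ℝ) < √(logb 2 (n : ℝ)) + 1 := Nat.ceil_lt_add_one (sqrt_nonneg _)
  have hnm : n ≤ windowLen (2 ^ m) m := by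
    have h1 : logb 2 (n : ℝ) ≤ (m * m : ℕ) := by
      push_cast
      rw [← sq]
      exact (sqrt_le_left (by positivity)).1 hm1
    rw [logb_le_iff_le_rpow (by norm_num) hn, rpow_natCast] at h1
    have h2 : n ≤ 2 ^ (m * m) := by exact_mod_cast h1
    rw [windowLen, ← pow_mul]
    omega
  have hmain := card_le_mul_ncard_cycleSpectrum hf hsurj hdeg (r := 2 ^ m) (L := m * m + 2)
    (k := m) (by positivity) (by
      rw [windowLen, ← pow_mul, pow_add]
      exact le_of_eq (by ring)) hnm
  have h3 : n ≤ 2 ^ (25 + 15 * m) * G.cycleSpectrum.ncard :=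
    hmain.trans (Nat.mul_le_mul_right _ (lossFactor_two_pow_le m))
  have h4 : (n : ℝ) ≤ (2 : ℝ) ^ (25 + 15 * m) * G.cycleSpectrum.ncard := by exact_mod_cast h3
  refine h4.trans (mul_le_mul_of_nonneg_right ?_ (Nat.cast_nonneg _))
  rw [← rpow_natCast]
  refine rpow_le_rpow_of_exponent_le (by norm_num) ?_
  push_cast
  linarith

open Real in
-- For `logb 2 R ≥ 9` the right exponent contains at least `18 * √R`. Otherwise `R ≤ 512`, so `√R ≤
-- 23` and the left exponent is at most `40 + 15 * 23 = 385`.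
theorem two_rpow_le_of_logb {R : ℝ} (hR : 2 ≤ R) :
    (2 : ℝ) ^ (40 + 15 * √R) ≤ (2 : ℝ) ^ (385 : ℝ) * (2 : ℝ) ^ (6 * √(R * logb 2 R)) := by
  rw [← rpow_add (by norm_num)]
  refine rpow_le_rpow_of_exponent_le (by norm_num) ?_
  have hs := sqrt_nonneg R
  rcases le_total 9 (logb 2 R) with h | h
  · have h1 : 3 * √R ≤ √(R * logb 2 R) := by
      have : √9 = (3 : ℝ) := by
        rw [show (9 : ℝ) = 3 ^ 2 by norm_num]; exact sqrt_sq (by norm_num)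
      rw [sqrt_mul (by linarith), mul_comm, ← this]
      exact mul_le_mul_of_nonneg_left (sqrt_le_sqrt h) hs
    linarith
  · rw [logb_le_iff_le_rpow (by norm_num) (by linarith)] at h
    have h1 : √R ≤ 23 := by
      rw [sqrt_le_left (by norm_num)]
      norm_num at h
      linarith
    have := sqrt_nonneg (R * logb 2 R)
    linarith

open Real in
theorem tendsto_logb_natCast : Filter.Tendsto (fun n : ℕ => logb 2 (n : ℝ)) Filter.atTop
    Filter.atTop :=
  (tendsto_logb_atTop (by norm_num)).comp tendsto_natCast_atTop_atTop

open Real in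
theorem tendsto_loss_exponent : Filter.Tendsto
    (fun n : ℕ => (40 + 15 * √(logb 2 (n : ℝ))) / logb 2 (n : ℝ)) Filter.atTop (nhds 0) := by
  have h1 := tendsto_logb_natCast.inv_tendsto_atTop
  have h2 := (tendsto_sqrt_atTop.comp tendsto_logb_natCast).inv_tendsto_atTop
  have h3 := (h1.const_mul 40).add (h2.const_mul 15)
  simp only [mul_zero, add_zero] at h3
  refine h3.congr fun n => ?_
  simp only [Pi.inv_apply, Function.comp]
  rw [add_div, mul_div_assoc, sqrt_div_self', div_eq_mul_inv, one_div]

end CycleLengths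

theorem mainTheorem1 :
    (∃ c : ℝ, 0 < c ∧
      ∀ (V : Type u) [Fintype V] [DecidableEq V] (G : SimpleGraph V) [DecidableRel G.Adj],
        G.IsHamiltonian → 3 ≤ G.minDegree →
          c * ((Fintype.card V : ℝ) /
              (2 : ℝ) ^ (6 * Real.sqrt (Real.logb 2 (Fintype.card V : ℝ) *
                Real.logb 2 (Real.logb 2 (Fintype.card V : ℝ)))))
            ≤ (G.cycleSpectrum.ncard : ℝ)) ∧
    (∃ ε : ℕ → ℝ, Filter.Tendsto ε Filter.atTop (nhds 0) ∧
      ∀ (V : Type u) [Fintype V] [DecidableEq V] (G : SimpleGraph V) [DecidableRel G.Adj],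
        G.IsHamiltonian → 3 ≤ G.minDegree →
          (Fintype.card V : ℝ) ^ (1 - ε (Fintype.card V)) ≤ (G.cycleSpectrum.ncard : ℝ)) := by
  refine ⟨⟨((2 : ℝ) ^ (385 : ℝ))⁻¹, by positivity, ?_⟩,
    fun n => (40 + 15 * Real.sqrt (Real.logb 2 (n : ℝ))) / Real.logb 2 (n : ℝ),
    tendsto_loss_exponent, ?_⟩
  · intro V _ _ G _ hG hdeg
    obtain ⟨h4, hn⟩ := card_le_rpow_mul_ncard_cycleSpectrum hG hdeg
    have hR : 2 ≤ Real.logb 2 (Fintype.card V : ℝ) := by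
      rw [Real.le_logb_iff_rpow_le (by norm_num) (by exact_mod_cast (by omega))]
      norm_num
      exact_mod_cast h4
    have h := hn.trans (mul_le_mul_of_nonneg_right (two_rpow_le_of_logb hR) (Nat.cast_nonneg _))
    rw [← div_eq_inv_mul, div_div, div_le_iff₀ (by positivity)]
    linarith
  · intro V _ _ G _ hG hdeg
    obtain ⟨h4, hn⟩ := card_le_rpow_mul_ncard_cycleSpectrum hG hdeg
    have hpos : (0 : ℝ) < Fintype.card V := by exact_mod_cast (by omega)
    have hR : 0 < Real.logb 2 (Fintype.card V : ℝ) :=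
      Real.logb_pos (by norm_num) (by exact_mod_cast (by omega))
    have key : (Fintype.card V : ℝ) ^
        ((40 + 15 * Real.sqrt (Real.logb 2 (Fintype.card V : ℝ))) /
          Real.logb 2 (Fintype.card V : ℝ)) =
        (2 : ℝ) ^ (40 + 15 * Real.sqrt (Real.logb 2 (Fintype.card V : ℝ))) := by
      conv_lhs => rw [← Real.rpow_logb (b := 2) (by norm_num) (by norm_num) hpos]
      rw [← Real.rpow_mul (by norm_num), Real.rpow_logb (by norm_num) (by norm_num) hpos,
        mul_div_cancel₀ _ hR.ne']
    rw [Real.rpow_sub hpos, Real.rpow_one, key, div_le_iff₀ (by positivity)]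
    linarith
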